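/- Let $H$ be a $2$-dimensional complex Hilbert space and $A$ a linear operator on $H$ with operator norm $\|A\|$ and eigenvalues $\lambda_1,\lambda_2$ (listed with algebraic multiplicity). **Hyperbolic plane.** The BCK model of the asymptotically closed hyperbolic plane is the closed unit disc $\{x^2+z^2\le 1\}$; points with $x^2+z^2<1$ are ordinary, points with $x^2+z^2=1$ are asymptotic. For ordinary $p,q$ put $$d(p,q)=\operatorname{arcosh}\frac{1-\langle p,q\rangle}{\sqrt{1-|p|^2}\sqrt{1-|q|^2}},$$ and for an asymptotic point $F_0$ and an ordinary $p$ let $d_{F_0}(p)=\log\frac{1-\langle F_0,p\rangle}{\sqrt{1-|p|^2}}$; the horocycles at $F_0$ are the level sets $C=\{d_{F_0}=c\}$ with $c\in\mathbb R$, and the signed distance from $C$ (negative inside) is $d_C=d_{F_0}-c$. The pCK model, without its ideal point, is $\{x^2\le z\}$, identified with the BCK model without $(0,1)$ by $(x,z)\mapsto\left(\frac{2x}{z+1},\frac{z-1}{z+1}\right)$, which carries over the geometry. A complex number $\lambda$ is represented in the pCK model by $\iota(\lambda)=(\operatorname{Re}\lambda,|\lambda|^2)$, that is, by $\left(\frac{2\operatorname{Re}\lambda}{|\lambda|^2+1},\frac{|\lambda|^2-1}{|\lambda|^2+1}\right)$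 in the BCK model. **Conics.** A possibly degenerate $h$-elliptical disc or asymptotically closed $h$-elliptic parabolic disc with generalized foci $F_1,F_2$ means: * if $F_1,F_2$ are ordinary: $\{p \text{ ordinary}: d(F_1,p)+d(F_2,p)\le m\}$ for some $m\ge d(F_1,F_2)$; * if one of them, $F$, is ordinary and the other, $F_0$, is asymptotic: $\{p\text{ ordinary}: d(F,p)+d_C(p)\le 0\}\cup\{F_0\}$ for some horocycle $C$ at $F_0$ with $d_C(F)\le 0$; * if $F_1\ne F_2$ are asymptotic: the set of ordinary points at distance at most $r$ from the $h$-line joining $F_1$ and $F_2$, together with $F_1,F_2$, for some $r\ge 0$; * if $F_1=F_2=F_0$ is asymptotic: $\{F_0\}$, or $\{p\text{ ordinary}: d_C(p)\le 0\}\cup\{F_0\}$ for some horocycle $C$ at $F_0$. A set touches the line $z=h$ from below if it meets this line and is contained in $\{z\le h\}$. **Theorem.** The conformal range of $A$, given in the two models by $$\mathrm{DW}^{\mathbb R}_{\mathrm{pCK}}(A)=\left\{\left(\frac{\operatorname{Re}\langle Ax,x\rangle}{|x|^2},\frac{|Ax|^2}{|x|^2}\right): x\ne0\right\},\qquad \mathrm{DW}^{\mathbb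 R}_{\mathrm{BCK}}(A)=\left\{\left(\frac{2\operatorname{Re}\langle Ax,x\rangle}{|Ax|^2+|x|^2},\frac{|Ax|^2-|x|^2}{|Ax|^2+|x|^2}\right): x\ne0\right\},$$ is in each model a possibly degenerate Euclidean elliptical disc (an affine image of the closed unit disc) strictly contained in the base set of the model; it is a possibly degenerate $h$-elliptical disc or asymptotically closed $h$-elliptic parabolic disc with generalized foci $\iota(\lambda_1),\iota(\lambda_2)$; and it touches from below the line $z_{\mathrm{pCK}}=\|A\|^2$ in the pCK model, respectively the line $z_{\mathrm{BCK}}=\frac{\|A\|^2-1}{\|A\|^2+1}$ in the BCK model. Moreover, in each model it is the only possibly degenerate $h$-elliptical disc or asymptotically closed $h$-elliptic parabolic disc with generalized foci $\iota(\lambda_1),\iota(\lambda_2)$ that touches this line from below. -/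

import Mathlib

noncomputable section

namespace ConformalRange

/-! ### The asymptotically closed hyperbolic plane -/

/-- Base set of the Beltrami--Cayley--Klein (BCK) model of the asymptotically closed hyperbolic
plane: the closed unit disc, in coordinates `(x, z)`. -/
def planeBCK : Set (ℝ × ℝ) := {p | p.1 ^ 2 + p.2 ^ 2 ≤ 1}

/-- Ordinary (non-asymptotic) points of the BCK model. -/
def IsOrdinary (p : ℝ × ℝ) : Prop := p.1 ^ 2 + p.2 ^ 2 < 1

/-- Asymptotic points of the BCK model. -/
def IsAsymptotic (p : ℝ × ℝ) : Prop := p.1 ^ 2 + p.2 ^ 2 = 1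

/-- Base set of the parabolic Cayley--Klein (pCK) model, without its ideal point in the direction
`(0, 1)`. The ideal point corresponds to `(0, 1)` in the BCK model. -/
def planePCK : Set (ℝ × ℝ) := {p | p.1 ^ 2 ≤ p.2}

/-- The projective correspondence from the pCK model to the BCK model; it maps `planePCK`
bijectively onto `planeBCK` without the point `(0, 1)`. -/
def toBCK (p : ℝ × ℝ) : ℝ × ℝ := (2 * p.1 / (p.2 + 1), (p.2 - 1) / (p.2 + 1))

/-- Hyperbolic distance of two ordinary points of the BCK model. -/
def hdist (p q : ℝ × ℝ) : ℝ :=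
  Real.arcosh ((1 - p.1 * q.1 - p.2 * q.2) /
    (√(1 - p.1 ^ 2 - p.2 ^ 2) * √(1 - q.1 ^ 2 - q.2 ^ 2)))

/-- The regularized distance from the asymptotic point `F₀` at the ordinary point `p`, that is
the limit of `hdist p (s • F₀) - hdist 0 (s • F₀)` as `s` increases to `1`. The horocycles with
asymptotic point `F₀` are the level sets `{p | distAsymp F₀ p = c}`, `c : ℝ`, and the signed
distance from that horocycle, negative in its inside, is `distAsymp F₀ p - c`. -/
def distAsymp (F₀ p : ℝ × ℝ) : ℝ :=
  Real.log ((1 - F₀.1 * p.1 - F₀.2 * p.2) / √(1 - p.1 ^ 2 - p.2 ^ 2))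

/-! ### Hyperbolic conical discs -/

/-- The set of points whose distances from the ordinary points `F₁`, `F₂` have sum at most `m`. -/
def ellipseDisk (F₁ F₂ : ℝ × ℝ) (m : ℝ) : Set (ℝ × ℝ) :=
  {p | IsOrdinary p ∧ hdist F₁ p + hdist F₂ p ≤ m}

/-- The asymptotically closed elliptic parabolic disc with ordinary focus `F`, asymptotic point
`F₀`, and belonging to the horocycle `C` of level `c` at `F₀`: the ordinary points `p` with
`d(F, p) + d_C(p) ≤ 0`, together with `F₀`. -/
def parabolaDisk (F F₀ : ℝ × ℝ) (c : ℝ) : Set (ℝ × ℝ) :=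
  {p | IsOrdinary p ∧ hdist F p + (distAsymp F₀ p - c) ≤ 0} ∪ {F₀}

/-- The asymptotically closed distance band of radius `r` around the hyperbolic line (a Euclidean
chord) with asymptotic points `F₁`, `F₂`. -/
def distanceBand (F₁ F₂ : ℝ × ℝ) (r : ℝ) : Set (ℝ × ℝ) :=
  {p | IsOrdinary p ∧ ∃ q ∈ openSegment ℝ F₁ F₂, hdist p q ≤ r} ∪ {F₁, F₂}

/-- The asymptotically closed horodisc at `F₀` bounded by the horocycle of level `c`. -/
def horodisk (F₀ : ℝ × ℝ) (c : ℝ) : Set (ℝ × ℝ) :=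
  {p | IsOrdinary p ∧ distAsymp F₀ p - c ≤ 0} ∪ {F₀}

/-- `IsFocalDisk F₁ F₂ S`: in the BCK model, `S` is a possibly degenerate `h`-elliptical disc or an
asymptotically closed possibly degenerate `h`-elliptic parabolic disc with generalized foci
`F₁`, `F₂`, asymptotic points being allowed as foci. The equality cases `m = hdist F₁ F₂`,
`c = distAsymp F₀ F`, `r = 0` are the degenerate ones (a point or segment, an asymptotically closed
half-line, an asymptotically closed line). -/
inductive IsFocalDisk : ℝ × ℝ → ℝ × ℝ → Set (ℝ × ℝ) → Prop
  | ellipse (F₁ F₂ : ℝ × ℝ) (m : ℝ) (h₁ : IsOrdinary F₁) (h₂ : IsOrdinary F₂)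
      (hm : hdist F₁ F₂ ≤ m) : IsFocalDisk F₁ F₂ (ellipseDisk F₁ F₂ m)
  | parabola (F F₀ : ℝ × ℝ) (c : ℝ) (h : IsOrdinary F) (h₀ : IsAsymptotic F₀)
      (hc : distAsymp F₀ F - c ≤ 0) : IsFocalDisk F F₀ (parabolaDisk F F₀ c)
  | parabola_swap (F F₀ : ℝ × ℝ) (c : ℝ) (h : IsOrdinary F) (h₀ : IsAsymptotic F₀)
      (hc : distAsymp F₀ F - c ≤ 0) : IsFocalDisk F₀ F (parabolaDisk F F₀ c)
  | band (F₁ F₂ : ℝ × ℝ) (r : ℝ) (h₁ : IsAsymptotic F₁) (h₂ : IsAsymptotic F₂)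
      (hne : F₁ ≠ F₂) (hr : 0 ≤ r) : IsFocalDisk F₁ F₂ (distanceBand F₁ F₂ r)
  | horo (F₀ : ℝ × ℝ) (c : ℝ) (h₀ : IsAsymptotic F₀) : IsFocalDisk F₀ F₀ (horodisk F₀ c)
  | point (F₀ : ℝ × ℝ) (h₀ : IsAsymptotic F₀) : IsFocalDisk F₀ F₀ {F₀}

/-- The same notion in pCK coordinates, whose geometry is carried over by `toBCK`. -/
def IsFocalDiskPCK (F₁ F₂ : ℝ × ℝ) (S : Set (ℝ × ℝ)) : Prop :=
  S ⊆ planePCK ∧ IsFocalDisk (toBCK F₁) (toBCK F₂) (toBCK '' S)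

/-- A possibly degenerate elliptical disc in the Euclidean sense: an affine image of the closed
unit disc. -/
def IsEllipticalDisk (S : Set (ℝ × ℝ)) : Prop :=
  ∃ f : (ℝ × ℝ) →ᵃ[ℝ] (ℝ × ℝ), S = f '' {p | p.1 ^ 2 + p.2 ^ 2 ≤ 1}

/-- `S` lies in the closed half-plane below the line `z = h` and meets this line. -/
def TouchesFromBelow (S : Set (ℝ × ℝ)) (h : ℝ) : Prop :=
  (∃ p ∈ S, p.2 = h) ∧ ∀ p ∈ S, p.2 ≤ h

/-! ### The conformal range -/

/-- The image of a complex number in the asymptotically closed plane, pCK model. -/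
def iotaPCK (l : ℂ) : ℝ × ℝ := (l.re, ‖l‖ ^ 2)

/-- The image of a complex number in the asymptotically closed plane, BCK model. -/
def iotaBCK (l : ℂ) : ℝ × ℝ :=
  (2 * l.re / (‖l‖ ^ 2 + 1), (‖l‖ ^ 2 - 1) / (‖l‖ ^ 2 + 1))

variable {H : Type*} [NormedAddCommGroup H] [InnerProductSpace ℂ H]

/-- The conformal range (real Davis--Wielandt shell) in the pCK model. -/
def rangePCK (A : H →L[ℂ] H) : Set (ℝ × ℝ) :=
  {p | ∃ x : H, x ≠ 0 ∧ p = ((inner ℂ (A x) x).re / ‖x‖ ^ 2, ‖A x‖ ^ 2 / ‖x‖ ^ 2)}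

/-- The conformal range (real Davis--Wielandt shell) in the BCK model. -/
def rangeBCK (A : H →L[ℂ] H) : Set (ℝ × ℝ) :=
  {p | ∃ x : H, x ≠ 0 ∧
    p = (2 * (inner ℂ (A x) x).re / (‖A x‖ ^ 2 + ‖x‖ ^ 2),
      (‖A x‖ ^ 2 - ‖x‖ ^ 2) / (‖A x‖ ^ 2 + ‖x‖ ^ 2))}

end ConformalRange

end

/-! Give each point of either model a homogeneous lift, so that the hyperbolic geometry is that of a
Lorentzian form (`lor` for BCK, `pair` for pCK). Write a, b for the pairings of p with F₁, F₂, and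
q, f₁, f₂ for the self-pairings. Whatever the type of the foci, every focal disc is cut out at
ordinary points by one inequality √((a² - q f₁)(b² - q f₂)) ≤ s q - a b with s at least the pairing
of F₁ and F₂; asymptotic foci are adjoined. Conversely every such s occurs
(`IsFocalDisk.exists_eq_focalSet`, `isFocalDisk_focalSet`). Ellipses, parabolas, distance bands and
horodiscs thus form a single one-parameter family.

On the operator side, a Schur basis turns A into the matrix with rows (l₁, t), (0, l₂), t ≥ 0, so
the range depends on t only (`rangePCK_eq_confDisk`). For t ≠ 0, eliminating the density matrix
gives `conicForm` ≥ 0 with s equal to the pairing of the foci plus t²/2. This is the squared form of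
the inequality above, and a Gram determinant identity rules out the wrong sign of s q - a b. For t =
0 both sides describe the segment between the foci. Hence the focal discs are exactly the sets
`confDisk l₁ l₂ t` with t ≥ 0 (`image_confDisk_eq_focalSet`).

The top height of the range is the maximum of |Ax|²/|x|², namely ‖A‖². Any top height N of the disc
with parameter t satisfies N² - N(|l₁|² + |l₂|² + t²) + |l₁ l₂|² = 0, which determines t² when N ≠
0; when N = 0, t vanishes. This gives uniqueness. Euclidean ellipticity holds because the rank one
density matrices form a sphere, whose linear image in the plane is an elliptical disc; in BCK the
normalization by the trace is replaced by |Ax|² + |x|². -/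

namespace ConformalRange

open Real

/-! ### Lorentzian pairing in the BCK model -/

/-- The Lorentzian pairing of two points of the BCK model, given the homogeneous weight `1`. -/
def lor (p q : ℝ × ℝ) : ℝ := 1 - p.1 * q.1 - p.2 * q.2

lemma lor_comm (p q : ℝ × ℝ) : lor p q = lor q p := by unfold lor; ring

lemma IsOrdinary.lor_self_pos {p : ℝ × ℝ} (hp : IsOrdinary p) : 0 < lor p p := by
  unfold IsOrdinary at hp; unfold lor; nlinarith

lemma IsAsymptotic.lor_self {p : ℝ × ℝ} (hp : IsAsymptotic p) : lor p p = 0 := by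
  unfold IsAsymptotic at hp; unfold lor; nlinarith

lemma IsOrdinary.not_isAsymptotic {p : ℝ × ℝ} (hp : IsOrdinary p) : ¬ IsAsymptotic p :=
  fun h => hp.ne h

lemma lor_pos {p q : ℝ × ℝ} (hp : IsOrdinary p) (hq : q ∈ planeBCK) : 0 < lor p q := by
  simp only [planeBCK, Set.mem_ofPred_eq] at hq
  unfold IsOrdinary at hp; unfold lor
  nlinarith [sq_nonneg (p.1 - q.1), sq_nonneg (p.2 - q.2)]

/-- Twice the pairing is (1 - |p|²) + (1 - |q|²) + |p - q|². -/
lemma lor_pos_of_ne {p q : ℝ × ℝ} (hp : p ∈ planeBCK) (hq : q ∈ planeBCK) (hne : p ≠ q) :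
    0 < lor p q := by
  simp only [planeBCK, Set.mem_ofPred_eq] at hp hq
  by_contra hneg
  unfold lor at hneg
  apply hne
  have h : (p.1 - q.1) ^ 2 + (p.2 - q.2) ^ 2 ≤ 0 := by nlinarith
  have h1 : p.1 - q.1 = 0 := by
    have := sq_nonneg (p.2 - q.2)
    exact pow_eq_zero_iff two_ne_zero |>.1 (le_antisymm (by linarith) (sq_nonneg _))
  have h2 : p.2 - q.2 = 0 := by
    have := sq_nonneg (p.1 - q.1)
    exact pow_eq_zero_iff two_ne_zero |>.1 (le_antisymm (by linarith) (sq_nonneg _))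
  exact Prod.ext (by linarith) (by linarith)

/-- Reverse Cauchy–Schwarz: the difference of the two sides is ⟨p, p - q⟩² + (1 - |p|²)|p - q|². -/
lemma lor_self_mul_lor_self_le {p : ℝ × ℝ} (hp : p ∈ planeBCK) (q : ℝ × ℝ) :
    lor p p * lor q q ≤ lor p q ^ 2 := by
  simp only [planeBCK, Set.mem_ofPred_eq] at hp
  unfold lor
  nlinarith [sq_nonneg (p.1 * (p.1 - q.1) + p.2 * (p.2 - q.2)),
    mul_nonneg (sub_nonneg.2 hp) (add_nonneg (sq_nonneg (p.1 - q.1)) (sq_nonneg (p.2 - q.2)))]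

lemma IsOrdinary.mem_planeBCK {p : ℝ × ℝ} (hp : IsOrdinary p) : p ∈ planeBCK := le_of_lt hp

lemma IsAsymptotic.mem_planeBCK {p : ℝ × ℝ} (hp : IsAsymptotic p) : p ∈ planeBCK := le_of_eq hp

lemma hdist_eq (p q : ℝ × ℝ) :
    hdist p q = arcosh (lor p q / (√(lor p p) * √(lor q q))) := by
  unfold hdist lor; ring_nf

lemma distAsymp_eq (p q : ℝ × ℝ) : distAsymp p q = log (lor p q / √(lor q q)) := by
  unfold distAsymp lor; ring_nf

lemma one_le_lor_div {p q : ℝ × ℝ} (hp : IsOrdinary p) (hq : IsOrdinary q) :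
    1 ≤ lor p q / (√(lor p p) * √(lor q q)) := by
  have h1 := hp.lor_self_pos
  have h2 := hq.lor_self_pos
  rw [one_le_div (by positivity), ← sqrt_mul h1.le]
  exact sqrt_le_iff.2 ⟨(lor_pos hp hq.mem_planeBCK).le,
    lor_self_mul_lor_self_le hp.mem_planeBCK q⟩

/-! ### Focal discs as a one-parameter family -/

/-- The candidates for focal discs with generalized foci `F₁`, `F₂`, in terms of the Lorentzian
pairing only. -/
def focalSet (F₁ F₂ : ℝ × ℝ) (s : ℝ) : Set (ℝ × ℝ) :=
  {p | IsOrdinary p ∧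
      √((lor F₁ p ^ 2 - lor p p * lor F₁ F₁) * (lor F₂ p ^ 2 - lor p p * lor F₂ F₂)) ≤
        s * lor p p - lor F₁ p * lor F₂ p} ∪
    {p | IsAsymptotic p ∧ (p = F₁ ∨ p = F₂)}

lemma focalSet_comm (F₁ F₂ : ℝ × ℝ) (s : ℝ) : focalSet F₁ F₂ s = focalSet F₂ F₁ s := by
  ext p
  simp only [focalSet, Set.mem_union, Set.mem_ofPred_eq]
  rw [mul_comm (lor F₁ p ^ 2 - _), mul_comm (lor F₁ p), or_comm (a := p = F₁)]

lemma arcosh_add_arcosh_le_iff {c₁ c₂ m : ℝ} (h₁ : 1 ≤ c₁) (h₂ : 1 ≤ c₂) (hm : 0 ≤ m) :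
    arcosh c₁ + arcosh c₂ ≤ m ↔ √(c₁ ^ 2 - 1) * √(c₂ ^ 2 - 1) ≤ cosh m - c₁ * c₂ := by
  have h := add_nonneg (arcosh_nonneg h₁) (arcosh_nonneg h₂)
  rw [← abs_of_nonneg h, ← abs_of_nonneg hm, ← cosh_le_cosh, abs_of_nonneg hm, cosh_add,
    cosh_arcosh h₁, cosh_arcosh h₂, sinh_arcosh h₁, sinh_arcosh h₂]
  constructor <;> intro h <;> linarith

lemma ellipseDisk_eq_focalSet {F₁ F₂ : ℝ × ℝ} {m : ℝ} (h₁ : IsOrdinary F₁) (h₂ : IsOrdinary F₂)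
    (hm : 0 ≤ m) :
    ellipseDisk F₁ F₂ m = focalSet F₁ F₂ (√(lor F₁ F₁) * √(lor F₂ F₂) * cosh m) := by
  ext p
  have hasymp : ¬ (IsAsymptotic p ∧ (p = F₁ ∨ p = F₂)) := by
    rintro ⟨hp, rfl | rfl⟩
    exacts [h₁.not_isAsymptotic hp, h₂.not_isAsymptotic hp]
  simp only [ellipseDisk, focalSet, Set.mem_union, Set.mem_ofPred_eq, hasymp, or_false]
  refine and_congr_right fun hp => ?_
  rw [hdist_eq, hdist_eq, arcosh_add_arcosh_le_iff (one_le_lor_div h₁ hp) (one_le_lor_div h₂ hp) hm]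
  have hc₁ := one_le_lor_div h₁ hp
  have hc₂ := one_le_lor_div h₂ hp
  have hu := sqrt_pos.2 h₁.lor_self_pos
  have hv := sqrt_pos.2 h₂.lor_self_pos
  have hw := sqrt_pos.2 hp.lor_self_pos
  have hu2 := sq_sqrt h₁.lor_self_pos.le
  have hv2 := sq_sqrt h₂.lor_self_pos.le
  have hw2 := sq_sqrt hp.lor_self_pos.le
  set u := √(lor F₁ F₁)
  set v := √(lor F₂ F₂)
  set w := √(lor p p)
  set c₁ := lor F₁ p / (u * w) with hc₁'
  set c₂ := lor F₂ p / (v * w) with hc₂'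
  have ha : lor F₁ p = c₁ * (u * w) := by rw [hc₁']; field_simp
  have hb : lor F₂ p = c₂ * (v * w) := by rw [hc₂']; field_simp
  rw [← hu2, ← hv2, ← hw2, ha, hb]
  have h1 : 0 ≤ c₁ ^ 2 - 1 := by nlinarith
  have h2 : 0 ≤ c₂ ^ 2 - 1 := by nlinarith
  rw [show ((c₁ * (u * w)) ^ 2 - w ^ 2 * u ^ 2) * ((c₂ * (v * w)) ^ 2 - w ^ 2 * v ^ 2) =
      (u * v * w ^ 2) ^ 2 * ((c₁ ^ 2 - 1) * (c₂ ^ 2 - 1)) by ring,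
    sqrt_mul (by positivity), sqrt_sq (by positivity), sqrt_mul h1,
    show u * v * cosh m * w ^ 2 - c₁ * (u * w) * (c₂ * (v * w)) =
      (u * v * w ^ 2) * (cosh m - c₁ * c₂) by ring, mul_le_mul_iff_right₀ (by positivity)]

/-- Exponentiating the distance inequality and using exp (arcosh c) = c + √(c² - 1) gives the
criterion, since `lor F₀ F₀ = 0` makes one factor under the root a perfect square. -/
lemma parabolaDisk_eq_focalSet {F F₀ : ℝ × ℝ} (c : ℝ) (h : IsOrdinary F) (h₀ : IsAsymptotic F₀) :
    parabolaDisk F F₀ c = focalSet F F₀ (√(lor F F) * exp c) := by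
  ext p
  have hasymp : IsAsymptotic p ∧ (p = F ∨ p = F₀) ↔ p = F₀ := by
    constructor
    · rintro ⟨hp, rfl | rfl⟩
      exacts [(h.not_isAsymptotic hp).elim, rfl]
    · rintro rfl; exact ⟨h₀, .inr rfl⟩
  simp only [parabolaDisk, focalSet, Set.mem_union, Set.mem_ofPred_eq, hasymp,
    Set.mem_singleton_iff]
  refine or_congr_left (and_congr_right fun hp => ?_)
  have hb : 0 < lor F₀ p := lor_comm F₀ p ▸ lor_pos hp h₀.mem_planeBCK
  have hc₁ := one_le_lor_div h hp
  have hu := sqrt_pos.2 h.lor_self_pos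
  have hw := sqrt_pos.2 hp.lor_self_pos
  have hu2 := sq_sqrt h.lor_self_pos.le
  have hw2 := sq_sqrt hp.lor_self_pos.le
  rw [hdist_eq, distAsymp_eq, h₀.lor_self, mul_zero, sub_zero]
  set u := √(lor F F)
  set w := √(lor p p)
  set c₁ := lor F p / (u * w) with hc₁'
  have ha : lor F p = c₁ * (u * w) := by rw [hc₁']; field_simp
  have h1 : 0 ≤ c₁ ^ 2 - 1 := by nlinarith
  rw [show arcosh c₁ + (log (lor F₀ p / w) - c) ≤ 0 ↔ arcosh c₁ + log (lor F₀ p / w) ≤ c by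
      constructor <;> intro h <;> linarith,
    ← exp_le_exp, exp_add, exp_arcosh hc₁, exp_log (by positivity), ← hu2, ← hw2, ha,
    show ((c₁ * (u * w)) ^ 2 - w ^ 2 * u ^ 2) * lor F₀ p ^ 2 =
      (u * w * lor F₀ p) ^ 2 * (c₁ ^ 2 - 1) by ring,
    sqrt_mul (by positivity), sqrt_sq (by positivity), mul_div_assoc', div_le_iff₀ hw,
    ← mul_le_mul_iff_right₀ (mul_pos hu hw)]
  constructor <;> intro h <;> nlinarith

lemma horodisk_eq_focalSet {F₀ : ℝ × ℝ} (c : ℝ) (h₀ : IsAsymptotic F₀) :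
    horodisk F₀ c = focalSet F₀ F₀ (2 * exp c ^ 2) := by
  ext p
  have hasymp : IsAsymptotic p ∧ (p = F₀ ∨ p = F₀) ↔ p = F₀ := by
    rw [or_self]
    exact ⟨fun h => h.2, fun h => ⟨h ▸ h₀, h⟩⟩
  simp only [horodisk, focalSet, Set.mem_union, Set.mem_ofPred_eq, hasymp,
    Set.mem_singleton_iff]
  refine or_congr_left (and_congr_right fun hp => ?_)
  have hb : 0 < lor F₀ p := lor_comm F₀ p ▸ lor_pos hp h₀.mem_planeBCK
  have hw := sqrt_pos.2 hp.lor_self_pos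
  have hw2 := sq_sqrt hp.lor_self_pos.le
  rw [distAsymp_eq, h₀.lor_self, mul_zero, sub_zero, sub_nonpos, ← exp_le_exp,
    exp_log (by positivity), div_le_iff₀ hw, sqrt_mul_self (by positivity)]
  rw [← hw2, sqrt_sq hw.le, ← pow_le_pow_iff_left₀ hb.le (by positivity) two_ne_zero]
  constructor <;> intro h <;> nlinarith

lemma singleton_eq_focalSet {F₀ : ℝ × ℝ} (h₀ : IsAsymptotic F₀) : {F₀} = focalSet F₀ F₀ 0 := by
  ext p
  have hasymp : IsAsymptotic p ∧ (p = F₀ ∨ p = F₀) ↔ p = F₀ := by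
    rw [or_self]
    exact ⟨fun h => h.2, fun h => ⟨h ▸ h₀, h⟩⟩
  simp only [focalSet, Set.mem_union, Set.mem_ofPred_eq, hasymp, Set.mem_singleton_iff]
  refine ⟨.inr, fun h => h.resolve_left ?_⟩
  rintro ⟨hp, h⟩
  have hb : 0 < lor F₀ p := lor_comm F₀ p ▸ lor_pos hp h₀.mem_planeBCK
  have := sqrt_nonneg ((lor F₀ p ^ 2 - lor p p * lor F₀ F₀) * (lor F₀ p ^ 2 - lor p p * lor F₀ F₀))
  nlinarith

/-- The lifts of F₁, F₂ are null, so a chord point with weights x, y has self-pairing 2xy `lor F₁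
F₂`. By AM–GM, (xa + yb)² ≥ 4xyab, which bounds cosh² of the distance below independently of the
chord point. -/
lemma exists_hdist_openSegment_le_iff {F₁ F₂ p : ℝ × ℝ} {r : ℝ} (h₁ : IsAsymptotic F₁)
    (h₂ : IsAsymptotic F₂) (hne : F₁ ≠ F₂) (hr : 0 ≤ r) (hp : IsOrdinary p) :
    (∃ q ∈ openSegment ℝ F₁ F₂, hdist p q ≤ r) ↔
      2 * (lor F₁ p * lor F₂ p) ≤ lor F₁ F₂ * cosh r ^ 2 * lor p p := by
  have ha : 0 < lor F₁ p := lor_comm F₁ p ▸ lor_pos hp h₁.mem_planeBCK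
  have hb : 0 < lor F₂ p := lor_comm F₂ p ▸ lor_pos hp h₂.mem_planeBCK
  have hf : 0 < lor F₁ F₂ := lor_pos_of_ne h₁.mem_planeBCK h₂.mem_planeBCK hne
  have hq := hp.lor_self_pos
  have hlor : ∀ x y : ℝ, x + y = 1 → lor p (x • F₁ + y • F₂) = x * lor F₁ p + y * lor F₂ p ∧
      lor (x • F₁ + y • F₂) (x • F₁ + y • F₂) = 2 * (x * y) * lor F₁ F₂ := by
    intro x y hxy
    have e1 := h₁.lor_self
    have e2 := h₂.lor_self
    obtain rfl : y = 1 - x := by linarith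
    simp only [lor, Prod.fst_add, Prod.snd_add, Prod.smul_fst, Prod.smul_snd, smul_eq_mul] at e1 e2 ⊢
    constructor
    · ring
    · linear_combination x ^ 2 * e1 + (1 - x) ^ 2 * e2
  have key : ∀ x y : ℝ, 0 < x → 0 < y → x + y = 1 → (hdist p (x • F₁ + y • F₂) ≤ r ↔
      (x * lor F₁ p + y * lor F₂ p) ^ 2 ≤ cosh r ^ 2 * (lor p p * (2 * (x * y) * lor F₁ F₂))) := by
    intro x y hx hy hxy
    obtain ⟨e1, e2⟩ := hlor x y hxy
    have hpos : 0 < lor p p * (2 * (x * y) * lor F₁ F₂) := by positivity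
    rw [hdist_eq, e1, e2, ← arcosh_cosh hr, arcosh_le_arcosh (by positivity) (cosh_pos r),
      ← sqrt_mul hq.le, div_le_iff₀ (sqrt_pos.2 hpos), arcosh_cosh hr,
      ← pow_le_pow_iff_left₀ (by positivity) (by positivity) two_ne_zero, mul_pow,
      sq_sqrt hpos.le]
  constructor
  · rintro ⟨q, ⟨x, y, hx, hy, hxy, rfl⟩, hd⟩
    rw [key x y hx hy hxy] at hd
    have hxy' : 0 < 2 * (x * y) := by positivity
    refine le_of_mul_le_mul_left ?_ hxy'
    nlinarith [sq_nonneg (x * lor F₁ p - y * lor F₂ p)]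
  · intro h
    -- Weights proportional to (b, a) give xa = yb, the equality case of AM–GM: this is the foot of
    -- the perpendicular from p.
    have hx : 0 < lor F₂ p / (lor F₁ p + lor F₂ p) := by positivity
    have hy : 0 < lor F₁ p / (lor F₁ p + lor F₂ p) := by positivity
    have hxy : lor F₂ p / (lor F₁ p + lor F₂ p) + lor F₁ p / (lor F₁ p + lor F₂ p) = 1 := by
      field_simp; ring
    refine ⟨_, ⟨_, _, hx, hy, hxy, rfl⟩, (key _ _ hx hy hxy).2 ?_⟩
    set a := lor F₁ p
    set b := lor F₂ p
    rw [show b / (a + b) * a + a / (a + b) * b = 2 * (a * b) / (a + b) by ring,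
      show cosh r ^ 2 * (lor p p * (2 * (b / (a + b) * (a / (a + b))) * lor F₁ F₂)) =
        2 * (a * b) * (lor F₁ F₂ * cosh r ^ 2 * lor p p) / (a + b) ^ 2 by field_simp, div_pow]
    gcongr
    rw [sq]
    gcongr

lemma distanceBand_eq_focalSet {F₁ F₂ : ℝ × ℝ} {r : ℝ} (h₁ : IsAsymptotic F₁)
    (h₂ : IsAsymptotic F₂) (hne : F₁ ≠ F₂) (hr : 0 ≤ r) :
    distanceBand F₁ F₂ r = focalSet F₁ F₂ (lor F₁ F₂ * cosh r ^ 2) := by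
  ext p
  have hasymp : IsAsymptotic p ∧ (p = F₁ ∨ p = F₂) ↔ p = F₁ ∨ p = F₂ := by
    refine ⟨fun h => h.2, fun h => ⟨?_, h⟩⟩
    rcases h with rfl | rfl
    exacts [h₁, h₂]
  simp only [distanceBand, focalSet, Set.mem_union, Set.mem_ofPred_eq, hasymp,
    Set.mem_insert_iff, Set.mem_singleton_iff]
  refine or_congr_left (and_congr_right fun hp => ?_)
  have ha : 0 < lor F₁ p := lor_comm F₁ p ▸ lor_pos hp h₁.mem_planeBCK
  have hb : 0 < lor F₂ p := lor_comm F₂ p ▸ lor_pos hp h₂.mem_planeBCK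
  rw [exists_hdist_openSegment_le_iff h₁ h₂ hne hr hp, h₁.lor_self, h₂.lor_self, mul_zero, sub_zero,
    sub_zero, ← mul_pow, sqrt_sq (by positivity)]
  constructor <;> intro h <;> linarith

lemma IsFocalDisk.exists_eq_focalSet {F₁ F₂ : ℝ × ℝ} {S : Set (ℝ × ℝ)} (h : IsFocalDisk F₁ F₂ S) :
    ∃ s, lor F₁ F₂ ≤ s ∧ S = focalSet F₁ F₂ s := by
  have hpar : ∀ F F₀ c, IsOrdinary F → IsAsymptotic F₀ → distAsymp F₀ F - c ≤ 0 →
      lor F F₀ ≤ √(lor F F) * exp c := by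
    intro F F₀ c hF hF₀ hc
    have hb := lor_pos hF hF₀.mem_planeBCK
    have hu := sqrt_pos.2 hF.lor_self_pos
    rw [distAsymp_eq, sub_nonpos, ← exp_le_exp, lor_comm, exp_log (by positivity),
      div_le_iff₀ hu] at hc
    linarith
  cases h with
  | ellipse _ _ m h₁ h₂ hm =>
    have hd := one_le_lor_div h₁ h₂
    rw [hdist_eq] at hm
    have hm0 := (arcosh_nonneg hd).trans hm
    refine ⟨_, ?_, ellipseDisk_eq_focalSet h₁ h₂ hm0⟩
    have hu := sqrt_pos.2 h₁.lor_self_pos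
    have hv := sqrt_pos.2 h₂.lor_self_pos
    rw [← abs_of_nonneg hm0, ← abs_of_nonneg (arcosh_nonneg hd), ← cosh_le_cosh, cosh_arcosh hd,
      div_le_iff₀ (by positivity)] at hm
    linarith
  | parabola _ _ c h h₀ hc => exact ⟨_, hpar _ _ c h h₀ hc, parabolaDisk_eq_focalSet c h h₀⟩
  | parabola_swap F F₀ c h h₀ hc =>
    exact ⟨_, lor_comm F₁ F₂ ▸ hpar _ _ c h h₀ hc,
      focalSet_comm F₁ F₂ _ ▸ parabolaDisk_eq_focalSet c h h₀⟩
  | band _ _ r h₁ h₂ hne hr =>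
    refine ⟨_, ?_, distanceBand_eq_focalSet h₁ h₂ hne hr⟩
    exact le_mul_of_one_le_right (lor_pos_of_ne h₁.mem_planeBCK h₂.mem_planeBCK hne).le
      (one_le_pow₀ (one_le_cosh r))
  | horo _ c h₀ => exact ⟨_, by rw [h₀.lor_self]; positivity, horodisk_eq_focalSet c h₀⟩
  | point _ h₀ => exact ⟨0, h₀.lor_self.le, singleton_eq_focalSet h₀⟩

lemma isFocalDisk_focalSet {F₁ F₂ : ℝ × ℝ} {s : ℝ} (hF₁ : F₁ ∈ planeBCK) (hF₂ : F₂ ∈ planeBCK)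
    (hs : lor F₁ F₂ ≤ s) : IsFocalDisk F₁ F₂ (focalSet F₁ F₂ s) := by
  have hpar : ∀ F F₀, IsOrdinary F → IsAsymptotic F₀ → lor F F₀ ≤ s →
      ∃ c, distAsymp F₀ F - c ≤ 0 ∧ s = √(lor F F) * exp c := by
    intro F F₀ hF hF₀ hs
    have hb := lor_pos hF hF₀.mem_planeBCK
    have hu := sqrt_pos.2 hF.lor_self_pos
    have hs0 : 0 < s := hb.trans_le hs
    refine ⟨log (s / √(lor F F)), ?_, ?_⟩
    · rw [sub_nonpos, distAsymp_eq, lor_comm]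
      gcongr
    · rw [exp_log (by positivity)]; field_simp
  rcases lt_or_eq_of_le (show F₁.1 ^ 2 + F₁.2 ^ 2 ≤ 1 from hF₁) with h₁ | h₁ <;>
    rcases lt_or_eq_of_le (show F₂.1 ^ 2 + F₂.2 ^ 2 ≤ 1 from hF₂) with h₂ | h₂
  · change IsOrdinary F₁ at h₁
    change IsOrdinary F₂ at h₂
    have hd := one_le_lor_div h₁ h₂
    have hu := sqrt_pos.2 h₁.lor_self_pos
    have hv := sqrt_pos.2 h₂.lor_self_pos
    have hs' : lor F₁ F₂ / (√(lor F₁ F₁) * √(lor F₂ F₂)) ≤ s / (√(lor F₁ F₁) * √(lor F₂ F₂)) := by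
      gcongr
    have hm := (arcosh_le_arcosh (by linarith) (by linarith)).2 hs'
    have := IsFocalDisk.ellipse F₁ F₂ _ h₁ h₂ (hdist_eq F₁ F₂ ▸ hm)
    rwa [ellipseDisk_eq_focalSet h₁ h₂ ((arcosh_nonneg hd).trans hm), cosh_arcosh (hd.trans hs'),
      mul_div_cancel₀ _ (by positivity)] at this
  · obtain ⟨c, hc, rfl⟩ := hpar F₁ F₂ h₁ h₂ hs
    rw [← parabolaDisk_eq_focalSet c h₁ h₂]
    exact .parabola F₁ F₂ c h₁ h₂ hc
  · obtain ⟨c, hc, rfl⟩ := hpar F₂ F₁ h₂ h₁ (lor_comm F₁ F₂ ▸ hs)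
    rw [focalSet_comm, ← parabolaDisk_eq_focalSet c h₂ h₁]
    exact .parabola_swap F₂ F₁ c h₂ h₁ hc
  · change IsAsymptotic F₁ at h₁
    change IsAsymptotic F₂ at h₂
    by_cases hne : F₁ = F₂
    · subst hne
      rw [h₁.lor_self] at hs
      rcases hs.eq_or_lt with rfl | hs
      · rw [← singleton_eq_focalSet h₁]; exact .point F₁ h₁
      -- Solves s = 2 (exp c)² for the level c.
      · have := IsFocalDisk.horo F₁ (log √(s / 2)) h₁
        rwa [horodisk_eq_focalSet _ h₁, exp_log (by positivity), sq_sqrt (by positivity),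
          mul_div_cancel₀ _ two_ne_zero] at this
    · have hf := lor_pos_of_ne hF₁ hF₂ hne
      have h1 : 1 ≤ s / lor F₁ F₂ := (one_le_div hf).2 hs
      have h1' := one_le_sqrt.2 h1
      have := IsFocalDisk.band F₁ F₂ (arcosh √(s / lor F₁ F₂)) h₁ h₂ hne (arcosh_nonneg h1')
      rwa [distanceBand_eq_focalSet h₁ h₂ hne (arcosh_nonneg h1'), cosh_arcosh h1',
        sq_sqrt (by positivity), mul_div_cancel₀ _ hf.ne'] at this

/-! ### Conic equation of the conformal range of a triangular matrix -/

/-- The Lorentzian pairing of two points of the pCK model, given the homogeneous weight `1`. -/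
noncomputable def pair (p q : ℝ × ℝ) : ℝ := (p.2 + q.2) / 2 - p.1 * q.1

/-- The conformal range of the matrix with rows `(l₁, t)` and `(0, l₂)`, in pCK coordinates. The
parameters `α`, `β`, `g + i h` are the entries of a density matrix of rank one. -/
def confDisk (l₁ l₂ : ℂ) (t : ℝ) : Set (ℝ × ℝ) :=
  {p | ∃ α β g h : ℝ, 0 ≤ α ∧ 0 ≤ β ∧ α + β = 1 ∧ g ^ 2 + h ^ 2 = α * β ∧
    p = (l₁.re * α + l₂.re * β + t * g,
      ‖l₁‖ ^ 2 * α + (‖l₂‖ ^ 2 + t ^ 2) * β + 2 * t * (l₁.re * g - l₁.im * h))}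

lemma norm_sq_eq (l : ℂ) : ‖l‖ ^ 2 = l.re ^ 2 + l.im ^ 2 := by
  rw [Complex.sq_norm, Complex.normSq_apply]; ring

lemma pair_iotaPCK_self (l : ℂ) : pair (iotaPCK l) (iotaPCK l) = l.im ^ 2 := by
  simp only [pair, iotaPCK, norm_sq_eq]; ring

/-- Quadratic form in `p` whose zero set is the boundary conic of the conformal disc. -/
noncomputable def conicForm (F₁ F₂ : ℝ × ℝ) (s : ℝ) (p : ℝ × ℝ) : ℝ :=
  pair p p * s ^ 2 - 2 * s * (pair F₁ p * pair F₂ p) + pair F₂ F₂ * pair F₁ p ^ 2 +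
    pair F₁ F₁ * pair F₂ p ^ 2 - pair p p * (pair F₁ F₁ * pair F₂ F₂)

lemma mem_confDisk_iff {l₁ l₂ : ℂ} {t : ℝ} {p : ℝ × ℝ} :
    p ∈ confDisk l₁ l₂ t ↔ ∃ β g h : ℝ, g ^ 2 + h ^ 2 = (1 - β) * β ∧
      p.1 = l₁.re * (1 - β) + l₂.re * β + t * g ∧
      p.2 = (l₁.re ^ 2 + l₁.im ^ 2) * (1 - β) + (l₂.re ^ 2 + l₂.im ^ 2 + t ^ 2) * β +
        2 * t * (l₁.re * g - l₁.im * h) := by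
  simp only [confDisk, Set.mem_ofPred_eq, norm_sq_eq]
  constructor
  · rintro ⟨α, β, g, h, -, -, hs, hgh, rfl⟩
    obtain rfl : α = 1 - β := by linarith
    exact ⟨β, g, h, hgh, rfl, rfl⟩
  · rintro ⟨β, g, h, hgh, h1, h2⟩
    have hβ : β ^ 2 ≤ β := by nlinarith [sq_nonneg g, sq_nonneg h]
    refine ⟨1 - β, β, g, h, by nlinarith, by nlinarith [sq_nonneg β], by ring, hgh, Prod.ext h1 h2⟩

/-- With l₁ real, h drops out of both coordinates. Then β and g are determined linearly by p, and a
suitable h exists exactly when g² ≤ (1 - β)β. -/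
lemma mem_confDisk_iff_of_im_eq_zero {l₁ l₂ : ℂ} {t : ℝ} (ht : t ≠ 0) (h₁ : l₁.im = 0)
    (p : ℝ × ℝ) : p ∈ confDisk l₁ l₂ t ↔
      0 ≤ conicForm (iotaPCK l₁) (iotaPCK l₂) (pair (iotaPCK l₁) (iotaPCK l₂) + t ^ 2 / 2) p := by
  obtain ⟨X, Z⟩ := p
  have hs : 0 < pair (iotaPCK l₁) (iotaPCK l₂) + t ^ 2 / 2 := by
    have : 0 < t ^ 2 := by positivity
    simp only [pair, iotaPCK, norm_sq_eq, h₁]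
    nlinarith [sq_nonneg (l₁.re - l₂.re), sq_nonneg l₂.im]
  have hs' : 2 * (pair (iotaPCK l₁) (iotaPCK l₂) + t ^ 2 / 2) =
      t ^ 2 + l₂.re ^ 2 + l₂.im ^ 2 - 2 * l₁.re * l₂.re + l₁.re ^ 2 := by
    simp only [pair, iotaPCK, norm_sq_eq, h₁]; ring
  rw [mem_confDisk_iff]
  set s := pair (iotaPCK l₁) (iotaPCK l₂) + t ^ 2 / 2
  set x₁ := l₁.re
  set x₂ := l₂.re
  set y₂ := l₂.im
  have hform : conicForm (iotaPCK l₁) (iotaPCK l₂) s (X, Z) =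
      (Z - X ^ 2) * s ^ 2 - 2 * s * (((Z + x₁ ^ 2) / 2 - X * x₁) *
        ((Z + x₂ ^ 2 + y₂ ^ 2) / 2 - X * x₂)) + y₂ ^ 2 * ((Z + x₁ ^ 2) / 2 - X * x₁) ^ 2 := by
    simp only [conicForm, pair, iotaPCK, norm_sq_eq, h₁]; ring
  -- The hypothesis on β says `pair F₁ p = s β`, which is what the two coordinate equations imply
  -- once g is eliminated.
  have key : ∀ β, s * β = (Z + x₁ ^ 2) / 2 - X * x₁ →
      conicForm (iotaPCK l₁) (iotaPCK l₂) s (X, Z) =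
        s ^ 2 * (t ^ 2 * ((1 - β) * β) - (X - x₁ * (1 - β) - x₂ * β) ^ 2) := by
    intro β hβ
    rw [hform, ← hβ]
    have ht2 : t ^ 2 = 2 * s - (x₂ ^ 2 + y₂ ^ 2 - 2 * x₁ * x₂ + x₁ ^ 2) := by linarith
    have hZ : Z = 2 * s * β - x₁ ^ 2 + 2 * X * x₁ := by linarith
    rw [ht2, hZ]; ring
  simp only [h₁]
  constructor
  · rintro ⟨β, g, h, hgh, hX, hZ⟩
    rw [key β (by rw [hX, hZ]; linear_combination β / 2 * hs'), ← hgh, hX]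
    have : 0 ≤ s ^ 2 * (t ^ 2 * h ^ 2) := by positivity
    nlinarith
  · intro h
    obtain ⟨β, hβ⟩ : ∃ β, s * β = (Z + x₁ ^ 2) / 2 - X * x₁ :=
      ⟨((Z + x₁ ^ 2) / 2 - X * x₁) / s, by field_simp⟩
    rw [key β hβ] at h
    have h' := nonneg_of_mul_nonneg_right h (by positivity)
    refine ⟨β, (X - x₁ * (1 - β) - x₂ * β) / t,
      √((1 - β) * β - ((X - x₁ * (1 - β) - x₂ * β) / t) ^ 2), ?_, ?_, ?_⟩
    · rw [sq_sqrt]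
      · ring
      · rw [div_pow, sub_nonneg, div_le_iff₀ (by positivity)]; linarith
    · field_simp; ring
    · field_simp
      linear_combination -2 * hβ + β * hs'

/-- Here g and h are both affine functions of β, so the constraint g² + h² = (1 - β)β is a quadratic
equation in β; its discriminant is a positive multiple of the conic form. -/
lemma mem_confDisk_iff_of_im_ne_zero {l₁ l₂ : ℂ} {t : ℝ} (ht : t ≠ 0) (h₁ : l₁.im ≠ 0)
    (p : ℝ × ℝ) : p ∈ confDisk l₁ l₂ t ↔
      0 ≤ conicForm (iotaPCK l₁) (iotaPCK l₂) (pair (iotaPCK l₁) (iotaPCK l₂) + t ^ 2 / 2) p := by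
  obtain ⟨X, Z⟩ := p
  rw [mem_confDisk_iff]
  set C := conicForm (iotaPCK l₁) (iotaPCK l₂) (pair (iotaPCK l₁) (iotaPCK l₂) + t ^ 2 / 2) (X, Z)
    with hC
  simp only [conicForm, pair, iotaPCK, norm_sq_eq] at hC
  set x₁ := l₁.re
  set y₁ := l₁.im
  set x₂ := l₂.re
  set y₂ := l₂.im
  -- Abbreviations chosen so that the coordinate equations read u - βd = t g and m - βn = 2 y₁ t h.
  obtain ⟨u, hu⟩ : ∃ u, u = X - x₁ := ⟨_, rfl⟩
  obtain ⟨d, hd⟩ : ∃ d, d = x₂ - x₁ := ⟨_, rfl⟩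
  obtain ⟨m, hm⟩ : ∃ m, m = 2 * x₁ * u - (Z - x₁ ^ 2 - y₁ ^ 2) := ⟨_, rfl⟩
  obtain ⟨n, hn⟩ : ∃ n, n = 2 * x₁ * d - (x₂ ^ 2 + y₂ ^ 2 + t ^ 2 - x₁ ^ 2 - y₁ ^ 2) := ⟨_, rfl⟩
  have hdisc : discrim (4 * y₁ ^ 2 * d ^ 2 + n ^ 2 + 4 * t ^ 2 * y₁ ^ 2)
      (-(8 * y₁ ^ 2 * u * d + 2 * m * n + 4 * t ^ 2 * y₁ ^ 2)) (4 * y₁ ^ 2 * u ^ 2 + m ^ 2) =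
      64 * y₁ ^ 2 * C := by
    rw [hC, hm, hn, hu, hd]; unfold discrim; ring
  have ha : 0 < 4 * y₁ ^ 2 * d ^ 2 + n ^ 2 + 4 * t ^ 2 * y₁ ^ 2 := by positivity
  constructor
  · rintro ⟨β, g, h, hgh, hX, hZ⟩
    simp only at hX hZ
    have e1 : u - β * d = t * g := by rw [hu, hd, hX]; ring
    have e2 : m - β * n = 2 * y₁ * (t * h) := by rw [hm, hn, hu, hd, hX, hZ]; ring
    have hK : (4 * y₁ ^ 2 * d ^ 2 + n ^ 2 + 4 * t ^ 2 * y₁ ^ 2) * (β * β) +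
        -(8 * y₁ ^ 2 * u * d + 2 * m * n + 4 * t ^ 2 * y₁ ^ 2) * β +
        (4 * y₁ ^ 2 * u ^ 2 + m ^ 2) = 0 := by
      linear_combination 4 * y₁ ^ 2 * (u - β * d + t * g) * e1 +
        (m - β * n + 2 * y₁ * (t * h)) * e2 + 4 * y₁ ^ 2 * t ^ 2 * hgh
    rw [discrim_eq_sq_of_quadratic_eq_zero hK] at hdisc
    have h64 : 0 < 64 * y₁ ^ 2 := by positivity
    exact nonneg_of_mul_nonneg_right (hdisc ▸ sq_nonneg _) h64
  · intro h
    obtain ⟨β, hβ⟩ := exists_quadratic_eq_zero ha.ne'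
      ⟨√(64 * y₁ ^ 2 * C), by rw [hdisc, mul_self_sqrt (by positivity)]⟩
    refine ⟨β, (u - β * d) / t, (m - β * n) / (2 * y₁ * t), ?_, ?_, ?_⟩
    · field_simp
      linear_combination hβ
    · rw [hu, hd]; field_simp; ring
    · rw [hm, hn, hu, hd]; field_simp; ring

lemma mem_confDisk_iff_conicForm {l₁ l₂ : ℂ} {t : ℝ} (ht : t ≠ 0) (p : ℝ × ℝ) :
    p ∈ confDisk l₁ l₂ t ↔
      0 ≤ conicForm (iotaPCK l₁) (iotaPCK l₂) (pair (iotaPCK l₁) (iotaPCK l₂) + t ^ 2 / 2) p := by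
  by_cases h : l₁.im = 0
  · exact mem_confDisk_iff_of_im_eq_zero ht h p
  · exact mem_confDisk_iff_of_im_ne_zero ht h p

/-- For the matrix A and a unit vector x giving p = (X, Z), the self-pairing Z - X² is ‖(A - X)x‖².
It vanishes only if X is a real eigenvalue with eigenvector x, which forces p to be a focus. In
density coordinates, multiplying by β makes the sum of squares explicit. -/
lemma pair_self_nonneg_of_mem {l₁ l₂ : ℂ} {t : ℝ} {p : ℝ × ℝ} (hp : p ∈ confDisk l₁ l₂ t) :
    0 ≤ pair p p ∧ (pair p p = 0 → p = iotaPCK l₁ ∨ p = iotaPCK l₂) := by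
  obtain ⟨α, β, g, h, hα, hβ, hs, hgh, hp⟩ := hp
  have hX := congrArg Prod.fst hp
  have hZ := congrArg Prod.snd hp
  simp only [norm_sq_eq] at hX hZ
  obtain ⟨X, Z⟩ := p
  simp only at hX hZ
  have hq : β * pair (X, Z) (X, Z) = ((l₁.re - X) * g - l₁.im * h + t * β) ^ 2 +
      ((l₁.re - X) * h + l₁.im * g) ^ 2 + ((l₂.re - X) ^ 2 + l₂.im ^ 2) * β ^ 2 := by
    have : pair (X, Z) (X, Z) = ((l₁.re - X) ^ 2 + l₁.im ^ 2) * α +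
        2 * t * ((l₁.re - X) * g - l₁.im * h) + t ^ 2 * β + ((l₂.re - X) ^ 2 + l₂.im ^ 2) * β := by
      simp only [pair]
      linear_combination hZ - 2 * X * hX - X ^ 2 * hs
    rw [this]
    linear_combination -((l₁.re - X) ^ 2 + l₁.im ^ 2) * hgh
  rcases hβ.eq_or_lt with rfl | hβ
  · have hg : g = 0 := by nlinarith [sq_nonneg g, sq_nonneg h]
    have hh : h = 0 := by nlinarith [sq_nonneg g, sq_nonneg h]
    obtain rfl : α = 1 := by linarith
    have hp' : (X, Z) = iotaPCK l₁ := by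
      rw [hp, hg, hh]; simp [iotaPCK]
    rw [hp', pair_iotaPCK_self]
    exact ⟨sq_nonneg _, fun _ => .inl rfl⟩
  · refine ⟨nonneg_of_mul_nonneg_right (hq ▸ by positivity) hβ, fun h0 => .inr ?_⟩
    rw [h0, mul_zero] at hq
    have h1 : ((l₂.re - X) ^ 2 + l₂.im ^ 2) * β ^ 2 = 0 := by
      refine le_antisymm ?_ (by positivity)
      nlinarith [sq_nonneg ((l₁.re - X) * g - l₁.im * h + t * β),
        sq_nonneg ((l₁.re - X) * h + l₁.im * g)]
    have h2 : (l₂.re - X) ^ 2 + l₂.im ^ 2 = 0 := by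
      simpa [hβ.ne'] using h1
    have h3 : l₂.re - X = 0 := by nlinarith [sq_nonneg (l₂.re - X), sq_nonneg l₂.im]
    have h4 : l₂.im = 0 := by nlinarith [sq_nonneg (l₂.re - X), sq_nonneg l₂.im]
    have h5 : Z = X ^ 2 := by simp only [pair] at h0; linarith
    refine Prod.ext (by simp only [iotaPCK]; linarith) ?_
    simp only [iotaPCK, norm_sq_eq, h4, h5]
    rw [show l₂.re = X by linarith]; ring

lemma iotaPCK_left_mem (l₁ l₂ : ℂ) (t : ℝ) : iotaPCK l₁ ∈ confDisk l₁ l₂ t :=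
  ⟨1, 0, 0, 0, by simp [iotaPCK]⟩

lemma iotaPCK_right_mem {l₁ l₂ : ℂ} (h₂ : l₂.im = 0) (t : ℝ) :
    iotaPCK l₂ ∈ confDisk l₁ l₂ t := by
  by_cases ht : t = 0
  · exact ⟨0, 1, 0, 0, by simp [iotaPCK, ht]⟩
  · rw [mem_confDisk_iff_conicForm ht, conicForm, pair_iotaPCK_self, h₂]
    simp

/-- The left side is `pair p p` times the Gram determinant of F₁, F₂, p. That determinant is the
square of the 3 × 3 determinant of their lifts (1, x, z) times 1/4, the determinant of the form. -/
lemma gram_identity (F₁ F₂ p : ℝ × ℝ) :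
    (pair F₁ p ^ 2 - pair p p * pair F₁ F₁) * (pair F₂ p ^ 2 - pair p p * pair F₂ F₂) -
      (pair F₁ F₂ * pair p p - pair F₁ p * pair F₂ p) ^ 2 =
    pair p p * ((p.1 - F₁.1) * (F₂.2 - F₁.2) - (p.2 - F₁.2) * (F₂.1 - F₁.1)) ^ 2 / 4 := by
  simp only [pair]; ring

/-- `conicForm` is minus the same Gram determinant with the entry `pair F₁ F₂` replaced by s. -/
lemma conicForm_identity (F₁ F₂ p : ℝ × ℝ) (s : ℝ) :
    (s * pair p p - pair F₁ p * pair F₂ p) ^ 2 -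
      (pair F₁ p ^ 2 - pair p p * pair F₁ F₁) * (pair F₂ p ^ 2 - pair p p * pair F₂ F₂) =
    pair p p * conicForm F₁ F₂ s p := by
  simp only [conicForm]; ring

lemma pair_self_mul_pair_self_le {p q : ℝ × ℝ} (hp : 0 ≤ pair p p) :
    pair p p * pair q q ≤ pair q p ^ 2 := by
  simp only [pair] at *
  nlinarith [sq_nonneg (p.1 - q.1), sq_nonneg (q.2 - p.2 - 2 * p.1 * (q.1 - p.1)),
    mul_nonneg hp (sq_nonneg (p.1 - q.1))]

lemma pair_self_mul_pair_self_lt {p q : ℝ × ℝ} (hp : 0 ≤ pair p p) (hq : 0 ≤ pair q q)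
    (hne : p ≠ q) : pair p p * pair q q < pair p q ^ 2 := by
  have hid : pair p q ^ 2 - pair p p * pair q q =
      ((pair p p - pair q q) ^ 2 + 2 * (pair p p + pair q q) * (p.1 - q.1) ^ 2 +
        ((p.1 - q.1) ^ 2) ^ 2) / 4 := by
    simp only [pair]; ring
  rw [← sub_pos, hid]
  by_cases hx : p.1 = q.1
  · have : pair p p - pair q q ≠ 0 := by
      simp only [pair, hx]
      exact fun h => hne (Prod.ext hx (by linarith))
    positivity
  · have := sub_ne_zero.2 hx
    positivity

/-- Let R be the radicand, y the right-hand side, and y₀ its value at t = 0. The conic inequality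
says y² ≥ R. The Gram identity gives y₀ ≥ -√R, and y > y₀, so the branch y ≤ -√R is impossible. -/
lemma mem_confDisk_iff_of_pos {l₁ l₂ : ℂ} {t : ℝ} (ht : t ≠ 0) {p : ℝ × ℝ} (hp : 0 < pair p p) :
    p ∈ confDisk l₁ l₂ t ↔
      √((pair (iotaPCK l₁) p ^ 2 - pair p p * pair (iotaPCK l₁) (iotaPCK l₁)) *
          (pair (iotaPCK l₂) p ^ 2 - pair p p * pair (iotaPCK l₂) (iotaPCK l₂))) ≤
        (pair (iotaPCK l₁) (iotaPCK l₂) + t ^ 2 / 2) * pair p p -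
          pair (iotaPCK l₁) p * pair (iotaPCK l₂) p := by
  rw [mem_confDisk_iff_conicForm ht]
  have h1 := gram_identity (iotaPCK l₁) (iotaPCK l₂) p
  have h2 := conicForm_identity (iotaPCK l₁) (iotaPCK l₂) p
    (pair (iotaPCK l₁) (iotaPCK l₂) + t ^ 2 / 2)
  have hnn := mul_nonneg (sub_nonneg.2 (pair_self_mul_pair_self_le (q := iotaPCK l₁) hp.le))
    (sub_nonneg.2 (pair_self_mul_pair_self_le (q := iotaPCK l₂) hp.le))
  set R := (pair (iotaPCK l₁) p ^ 2 - pair p p * pair (iotaPCK l₁) (iotaPCK l₁)) *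
    (pair (iotaPCK l₂) p ^ 2 - pair p p * pair (iotaPCK l₂) (iotaPCK l₂))
  set y₀ := pair (iotaPCK l₁) (iotaPCK l₂) * pair p p - pair (iotaPCK l₁) p * pair (iotaPCK l₂) p
    with hy₀
  set y := (pair (iotaPCK l₁) (iotaPCK l₂) + t ^ 2 / 2) * pair p p -
    pair (iotaPCK l₁) p * pair (iotaPCK l₂) p with hy
  have hlt : y₀ < y := by
    have : 0 < t ^ 2 / 2 * pair p p := by positivity
    rw [hy₀, hy]; linarith
  have hR : y₀ ^ 2 ≤ R := by
    have := mul_nonneg hp.le (sq_nonneg ((p.1 - (iotaPCK l₁).1) * ((iotaPCK l₂).2 - (iotaPCK l₁).2) -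
      (p.2 - (iotaPCK l₁).2) * ((iotaPCK l₂).1 - (iotaPCK l₁).1)))
    linarith
  have hy₀' := (abs_le.1 (abs_le_sqrt hR)).1
  rw [← mul_nonneg_iff_of_pos_left hp, ← h2, sub_nonneg]
  constructor
  · intro h
    have habs := sqrt_le_sqrt h
    rw [sqrt_sq_eq_abs] at habs
    rcases abs_cases y with h | h <;> linarith
  · intro h
    exact (sqrt_le_left ((sqrt_nonneg R).trans h)).1 h

/-- At the extreme parameter the criterion forces the Gram determinant to vanish, so p is collinear
with the foci. The sign of the right-hand side, (1 - β)β times a positive number for distinct foci,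
then places p between them. -/
lemma mem_confDisk_zero_iff_of_pos {l₁ l₂ : ℂ} {p : ℝ × ℝ} (hp : 0 < pair p p) :
    p ∈ confDisk l₁ l₂ 0 ↔
      √((pair (iotaPCK l₁) p ^ 2 - pair p p * pair (iotaPCK l₁) (iotaPCK l₁)) *
          (pair (iotaPCK l₂) p ^ 2 - pair p p * pair (iotaPCK l₂) (iotaPCK l₂))) ≤
        pair (iotaPCK l₁) (iotaPCK l₂) * pair p p -
          pair (iotaPCK l₁) p * pair (iotaPCK l₂) p := by
  have hgram := gram_identity (iotaPCK l₁) (iotaPCK l₂) p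
  have hnn := mul_nonneg (sub_nonneg.2 (pair_self_mul_pair_self_le (q := iotaPCK l₁) hp.le))
    (sub_nonneg.2 (pair_self_mul_pair_self_le (q := iotaPCK l₂) hp.le))
  set R := (pair (iotaPCK l₁) p ^ 2 - pair p p * pair (iotaPCK l₁) (iotaPCK l₁)) *
    (pair (iotaPCK l₂) p ^ 2 - pair p p * pair (iotaPCK l₂) (iotaPCK l₂))
  set F₁ := iotaPCK l₁ with hF₁
  set F₂ := iotaPCK l₂ with hF₂
  have hq₁ : 0 ≤ pair F₁ F₁ := by rw [hF₁, pair_iotaPCK_self]; positivity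
  have hq₂ : 0 ≤ pair F₂ F₂ := by rw [hF₂, pair_iotaPCK_self]; positivity
  have hmem : p ∈ confDisk l₁ l₂ 0 ↔ ∃ β, 0 ≤ (1 - β) * β ∧
      p.1 = F₁.1 * (1 - β) + F₂.1 * β ∧ p.2 = F₁.2 * (1 - β) + F₂.2 * β := by
    rw [mem_confDisk_iff]
    simp only [hF₁, hF₂, iotaPCK, norm_sq_eq]
    constructor
    · rintro ⟨β, g, h, hgh, h1, h2⟩
      exact ⟨β, hgh ▸ by positivity, by linarith, by linarith⟩
    · rintro ⟨β, hβ, h1, h2⟩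
      exact ⟨β, √((1 - β) * β), 0, by rw [sq_sqrt hβ]; ring, by linarith, by linarith⟩
  have hseg : ∀ β, p.1 = F₁.1 * (1 - β) + F₂.1 * β → p.2 = F₁.2 * (1 - β) + F₂.2 * β →
      pair F₁ F₂ * pair p p - pair F₁ p * pair F₂ p =
        (1 - β) * β * (pair F₁ F₂ ^ 2 - pair F₁ F₁ * pair F₂ F₂) := by
    intro β h1 h2
    simp only [pair, h1, h2]; ring
  rw [hmem]
  constructor
  · rintro ⟨β, hβ, h1, h2⟩
    have hy : 0 ≤ pair F₁ F₂ * pair p p - pair F₁ p * pair F₂ p := by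
      rw [hseg β h1 h2]
      refine mul_nonneg hβ (sub_nonneg.2 ?_)
      rw [mul_comm (pair F₁ F₁)]
      exact pair_self_mul_pair_self_le hq₂
    have hdet : (p.1 - F₁.1) * (F₂.2 - F₁.2) - (p.2 - F₁.2) * (F₂.1 - F₁.1) = 0 := by
      rw [h1, h2]; ring
    rw [hdet] at hgram
    exact (sqrt_le_left hy).2 (by linarith)
  · intro h
    have hy := (sqrt_nonneg R).trans h
    have hle := (sqrt_le_left hy).1 h
    have hdet : (p.1 - F₁.1) * (F₂.2 - F₁.2) - (p.2 - F₁.2) * (F₂.1 - F₁.1) = 0 := by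
      have : pair p p * ((p.1 - F₁.1) * (F₂.2 - F₁.2) - (p.2 - F₁.2) * (F₂.1 - F₁.1)) ^ 2 ≤ 0 := by
        linarith
      have h0 := le_antisymm this (mul_nonneg hp.le (sq_nonneg _))
      simpa [hp.ne'] using h0
    by_cases hne : F₁ = F₂
    · have hpF : p = F₁ := by
        by_contra hpF
        have := pair_self_mul_pair_self_lt hq₁ hp.le (Ne.symm hpF)
        rw [← hne] at hy
        nlinarith
      exact ⟨0, by simp, by rw [hpF]; ring, by rw [hpF]; ring⟩
    · obtain ⟨β, h1, h2⟩ : ∃ β, p.1 = F₁.1 * (1 - β) + F₂.1 * β ∧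
          p.2 = F₁.2 * (1 - β) + F₂.2 * β := by
        by_cases hx : F₂.1 - F₁.1 = 0
        · have hz : F₂.2 - F₁.2 ≠ 0 := fun hz => hne (Prod.ext (by linarith) (by linarith))
          refine ⟨(p.2 - F₁.2) / (F₂.2 - F₁.2), ?_, by field_simp; ring⟩
          have : p.1 - F₁.1 = 0 := by simpa [hx, hz] using hdet
          linear_combination this - (p.2 - F₁.2) / (F₂.2 - F₁.2) * hx
        · refine ⟨(p.1 - F₁.1) / (F₂.1 - F₁.1), by field_simp; ring, ?_⟩
          field_simp
          linear_combination -hdet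
      refine ⟨β, ?_, h1, h2⟩
      rw [hseg β h1 h2] at hy
      exact nonneg_of_mul_nonneg_left hy (sub_pos.2 (pair_self_mul_pair_self_lt hq₁ hq₂ hne))

/-! ### Transfer between the pCK and BCK models -/

lemma mem_planePCK_iff {p : ℝ × ℝ} : p ∈ planePCK ↔ 0 ≤ pair p p := by
  simp only [planePCK, Set.mem_ofPred_eq, pair]
  constructor <;> intro h <;> nlinarith

lemma add_one_pos_of_mem_planePCK {p : ℝ × ℝ} (hp : p ∈ planePCK) : 0 < p.2 + 1 := by
  simp only [planePCK, Set.mem_ofPred_eq] at hp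
  nlinarith [sq_nonneg p.1]

/-- The projective correspondence lifts to a Lorentz similarity; the factors 2 / (z + 1) come from
renormalizing the homogeneous weights to 1. -/
lemma lor_toBCK {p q : ℝ × ℝ} (hp : p.2 + 1 ≠ 0) (hq : q.2 + 1 ≠ 0) :
    lor (toBCK p) (toBCK q) = 2 / (p.2 + 1) * (2 / (q.2 + 1)) * pair p q := by
  simp only [lor, toBCK, pair]; field_simp; ring

lemma iotaBCK_eq (l : ℂ) : iotaBCK l = toBCK (iotaPCK l) := rfl

lemma iotaPCK_mem_planePCK (l : ℂ) : iotaPCK l ∈ planePCK := by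
  rw [mem_planePCK_iff, pair_iotaPCK_self]; positivity

lemma isOrdinary_iff_lor_self {p : ℝ × ℝ} : IsOrdinary p ↔ 0 < lor p p := by
  unfold IsOrdinary lor; constructor <;> intro h <;> nlinarith

lemma isAsymptotic_iff_lor_self {p : ℝ × ℝ} : IsAsymptotic p ↔ lor p p = 0 := by
  unfold IsAsymptotic lor; constructor <;> intro h <;> nlinarith

lemma isOrdinary_toBCK_iff {p : ℝ × ℝ} (hp : p ∈ planePCK) :
    IsOrdinary (toBCK p) ↔ 0 < pair p p := by
  have := add_one_pos_of_mem_planePCK hp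
  rw [isOrdinary_iff_lor_self, lor_toBCK this.ne' this.ne']
  exact mul_pos_iff_of_pos_left (by positivity)

lemma isAsymptotic_toBCK_iff {p : ℝ × ℝ} (hp : p ∈ planePCK) :
    IsAsymptotic (toBCK p) ↔ pair p p = 0 := by
  have := add_one_pos_of_mem_planePCK hp
  rw [isAsymptotic_iff_lor_self, lor_toBCK this.ne' this.ne', mul_eq_zero_iff_left (by positivity)]

lemma toBCK_mem_planeBCK {p : ℝ × ℝ} (hp : p ∈ planePCK) : toBCK p ∈ planeBCK := by
  rcases (mem_planePCK_iff.1 hp).eq_or_lt with h | h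
  · exact ((isAsymptotic_toBCK_iff hp).2 h.symm).mem_planeBCK
  · exact ((isOrdinary_toBCK_iff hp).2 h).mem_planeBCK

lemma toBCK_injOn : Set.InjOn toBCK planePCK := by
  intro p hp q hq h
  have hp' := (add_one_pos_of_mem_planePCK hp).ne'
  have hq' := (add_one_pos_of_mem_planePCK hq).ne'
  have h1 := congrArg Prod.fst h
  have h2 := congrArg Prod.snd h
  simp only [toBCK] at h1 h2
  have hz : p.2 = q.2 := by
    field_simp at h2
    linarith
  rw [hz] at h1
  field_simp at h1
  exact Prod.ext h1 hz

lemma IsOrdinary.exists_toBCK_eq {p : ℝ × ℝ} (hp : IsOrdinary p) :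
    ∃ q ∈ planePCK, toBCK q = p := by
  have hz : 0 < 1 - p.2 := by unfold IsOrdinary at hp; nlinarith [sq_nonneg p.1]
  refine ⟨(p.1 / (1 - p.2), (1 + p.2) / (1 - p.2)), ?_, ?_⟩
  · simp only [planePCK, Set.mem_ofPred_eq]
    unfold IsOrdinary at hp
    rw [div_pow, div_le_div_iff₀ (by positivity) hz]
    nlinarith
  · have : (1 + p.2) / (1 - p.2) + 1 = 2 / (1 - p.2) := by field_simp; ring
    ext
    · simp only [toBCK, this]; field_simp
    · simp only [toBCK, this]; field_simp; ring

lemma confDisk_subset_planePCK (l₁ l₂ : ℂ) (t : ℝ) : confDisk l₁ l₂ t ⊆ planePCK :=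
  fun _ hp => mem_planePCK_iff.2 (pair_self_nonneg_of_mem hp).1

/-- Homogeneity of the criterion defining `focalSet`. -/
lemma sqrt_le_scale_iff {a b f₁ f₂ q s c₁ c₂ c : ℝ} (h₁ : 0 < c₁) (h₂ : 0 < c₂) (hc : 0 < c) :
    √(((c₁ * c * a) ^ 2 - c * c * q * (c₁ * c₁ * f₁)) *
        ((c₂ * c * b) ^ 2 - c * c * q * (c₂ * c₂ * f₂))) ≤
      c₁ * c₂ * s * (c * c * q) - c₁ * c * a * (c₂ * c * b) ↔
    √((a ^ 2 - q * f₁) * (b ^ 2 - q * f₂)) ≤ s * q - a * b := by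
  rw [show ((c₁ * c * a) ^ 2 - c * c * q * (c₁ * c₁ * f₁)) *
        ((c₂ * c * b) ^ 2 - c * c * q * (c₂ * c₂ * f₂)) =
      (c₁ * c₂ * c ^ 2) ^ 2 * ((a ^ 2 - q * f₁) * (b ^ 2 - q * f₂)) by ring,
    sqrt_mul (by positivity), sqrt_sq (by positivity),
    show c₁ * c₂ * s * (c * c * q) - c₁ * c * a * (c₂ * c * b) =
      (c₁ * c₂ * c ^ 2) * (s * q - a * b) by ring, mul_le_mul_iff_right₀ (by positivity)]

lemma image_confDisk_eq_focalSet (l₁ l₂ : ℂ) (t : ℝ) :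
    toBCK '' confDisk l₁ l₂ t = focalSet (iotaBCK l₁) (iotaBCK l₂)
      (2 / (‖l₁‖ ^ 2 + 1) * (2 / (‖l₂‖ ^ 2 + 1)) *
        (pair (iotaPCK l₁) (iotaPCK l₂) + t ^ 2 / 2)) := by
  have hcrit : ∀ p ∈ planePCK, 0 < pair p p → (p ∈ confDisk l₁ l₂ t ↔
      √((lor (iotaBCK l₁) (toBCK p) ^ 2 - lor (toBCK p) (toBCK p) * lor (iotaBCK l₁) (iotaBCK l₁)) *
        (lor (iotaBCK l₂) (toBCK p) ^ 2 - lor (toBCK p) (toBCK p) * lor (iotaBCK l₂) (iotaBCK l₂)))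
      ≤ 2 / (‖l₁‖ ^ 2 + 1) * (2 / (‖l₂‖ ^ 2 + 1)) *
        (pair (iotaPCK l₁) (iotaPCK l₂) + t ^ 2 / 2) * lor (toBCK p) (toBCK p) -
          lor (iotaBCK l₁) (toBCK p) * lor (iotaBCK l₂) (toBCK p)) := by
    intro p hp hpos
    have h₁ := add_one_pos_of_mem_planePCK (iotaPCK_mem_planePCK l₁)
    have h₂ := add_one_pos_of_mem_planePCK (iotaPCK_mem_planePCK l₂)
    have h := add_one_pos_of_mem_planePCK hp
    have e₁ : ‖l₁‖ ^ 2 + 1 = (iotaPCK l₁).2 + 1 := rfl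
    have e₂ : ‖l₂‖ ^ 2 + 1 = (iotaPCK l₂).2 + 1 := rfl
    rw [iotaBCK_eq, iotaBCK_eq, lor_toBCK h₁.ne' h.ne', lor_toBCK h₂.ne' h.ne', lor_toBCK h.ne' h.ne',
      lor_toBCK h₁.ne' h₁.ne', lor_toBCK h₂.ne' h₂.ne', e₁, e₂,
      sqrt_le_scale_iff (by positivity) (by positivity) (by positivity)]
    by_cases ht : t = 0
    · subst ht
      rw [mem_confDisk_zero_iff_of_pos hpos]
      norm_num
    · exact mem_confDisk_iff_of_pos ht hpos
  ext p'
  simp only [focalSet, Set.mem_union, Set.mem_ofPred_eq, Set.mem_image]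
  constructor
  · rintro ⟨p, hp, rfl⟩
    have hpl := confDisk_subset_planePCK _ _ _ hp
    obtain ⟨h0, heq⟩ := pair_self_nonneg_of_mem hp
    rcases h0.eq_or_lt with h0 | h0
    · exact .inr ⟨(isAsymptotic_toBCK_iff hpl).2 h0.symm,
        (heq h0.symm).imp (congrArg toBCK) (congrArg toBCK)⟩
    · exact .inl ⟨(isOrdinary_toBCK_iff hpl).2 h0, (hcrit p hpl h0).1 hp⟩
  · rintro (⟨hord, h⟩ | ⟨has, rfl | rfl⟩)
    · obtain ⟨p, hpl, rfl⟩ := hord.exists_toBCK_eq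
      exact ⟨p, (hcrit p hpl ((isOrdinary_toBCK_iff hpl).1 hord)).2 h, rfl⟩
    · exact ⟨_, iotaPCK_left_mem _ _ _, rfl⟩
    -- An asymptotic focus has zero self-pairing, so l₂ is real.
    · refine ⟨_, iotaPCK_right_mem ?_ _, rfl⟩
      rw [iotaBCK_eq, isAsymptotic_toBCK_iff (iotaPCK_mem_planePCK _), pair_iotaPCK_self] at has
      exact pow_eq_zero_iff two_ne_zero |>.1 has

lemma lor_iotaBCK (l₁ l₂ : ℂ) : lor (iotaBCK l₁) (iotaBCK l₂) =
    2 / (‖l₁‖ ^ 2 + 1) * (2 / (‖l₂‖ ^ 2 + 1)) * pair (iotaPCK l₁) (iotaPCK l₂) :=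
  lor_toBCK (add_one_pos_of_mem_planePCK (iotaPCK_mem_planePCK l₁)).ne'
    (add_one_pos_of_mem_planePCK (iotaPCK_mem_planePCK l₂)).ne'

lemma isFocalDisk_image_confDisk (l₁ l₂ : ℂ) (t : ℝ) :
    IsFocalDisk (iotaBCK l₁) (iotaBCK l₂) (toBCK '' confDisk l₁ l₂ t) := by
  rw [image_confDisk_eq_focalSet]
  refine isFocalDisk_focalSet (toBCK_mem_planeBCK (iotaPCK_mem_planePCK l₁))
    (toBCK_mem_planeBCK (iotaPCK_mem_planePCK l₂)) ?_
  rw [lor_iotaBCK]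
  gcongr
  linarith [sq_nonneg t]

lemma IsFocalDisk.exists_eq_image_confDisk {l₁ l₂ : ℂ} {S : Set (ℝ × ℝ)}
    (hS : IsFocalDisk (iotaBCK l₁) (iotaBCK l₂) S) :
    ∃ t, 0 ≤ t ∧ S = toBCK '' confDisk l₁ l₂ t := by
  obtain ⟨s, hs, rfl⟩ := hS.exists_eq_focalSet
  rw [lor_iotaBCK] at hs
  have hk : 0 < 2 / (‖l₁‖ ^ 2 + 1) * (2 / (‖l₂‖ ^ 2 + 1)) := by positivity
  set k := 2 / (‖l₁‖ ^ 2 + 1) * (2 / (‖l₂‖ ^ 2 + 1)) with hk'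
  have hs' : pair (iotaPCK l₁) (iotaPCK l₂) ≤ s / k := by
    rw [le_div_iff₀ hk]; linarith
  refine ⟨√(2 * (s / k - pair (iotaPCK l₁) (iotaPCK l₂))), sqrt_nonneg _, ?_⟩
  rw [image_confDisk_eq_focalSet, sq_sqrt (by linarith), ← hk']
  congr 1
  field_simp
  ring

/-! ### The topmost point -/

/-- This is det(N - A*A) = 0 for the triangular matrix: N - A*A is positive semidefinite because N
is an upper bound, and degenerate because N is attained. -/
lemma sub_mul_sub_eq_of_touchesFromBelow {l₁ l₂ : ℂ} {t N : ℝ}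
    (h : TouchesFromBelow (confDisk l₁ l₂ t) N) :
    (N - ‖l₁‖ ^ 2) * (N - ‖l₂‖ ^ 2 - t ^ 2) = t ^ 2 * ‖l₁‖ ^ 2 := by
  obtain ⟨⟨_, ⟨α, β, g, h, hα, hβ, hs, hgh, rfl⟩, hN⟩, hle⟩ := h
  have hle' : ∀ α β g h : ℝ, 0 ≤ α → 0 ≤ β → α + β = 1 → g ^ 2 + h ^ 2 = α * β →
      ‖l₁‖ ^ 2 * α + (‖l₂‖ ^ 2 + t ^ 2) * β + 2 * t * (l₁.re * g - l₁.im * h) ≤ N :=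
    fun α β g h h1 h2 h3 h4 => hle _ ⟨α, β, g, h, h1, h2, h3, h4, rfl⟩
  simp only at hN
  set P := N - ‖l₁‖ ^ 2 with hP
  set R := N - ‖l₂‖ ^ 2 - t ^ 2 with hR
  have hn := norm_sq_eq l₁
  have hP0 : 0 ≤ P := by have := hle' 1 0 0 0 (by simp) (by simp) (by simp) (by simp); linarith
  have hR0 : 0 ≤ R := by have := hle' 0 1 0 0 (by simp) (by simp) (by simp) (by simp); linarith
  apply le_antisymm
  -- At the top point, 4PRαβ ≤ (Pα + Rβ)² ≤ 4t²|l₁|²αβ. If PR were larger than t²|l₁|², then αβ = 0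
  -- and Pα + Rβ = 0, contradicting P, R > 0.
  · have hc : (l₁.re * g - l₁.im * h) ^ 2 ≤ ‖l₁‖ ^ 2 * (α * β) := by
      rw [← hgh, hn]; nlinarith [sq_nonneg (l₁.re * h + l₁.im * g)]
    have he : P * α + R * β = 2 * t * (l₁.re * g - l₁.im * h) := by
      rw [hP, hR]; linear_combination N * hs - hN
    have h4 : (P * α + R * β) ^ 2 ≤ 4 * t ^ 2 * (‖l₁‖ ^ 2 * (α * β)) := by
      rw [he]; nlinarith [sq_nonneg t]
    by_contra! hlt
    have hαβ : α * β = 0 := by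
      refine le_antisymm ?_ (mul_nonneg hα hβ)
      by_contra! hpos
      nlinarith [sq_nonneg (P * α - R * β), mul_pos hpos (sub_pos.2 hlt)]
    rw [hαβ, mul_zero, mul_zero] at h4
    have h5 : P * α + R * β = 0 := pow_eq_zero_iff two_ne_zero |>.1 (le_antisymm h4 (sq_nonneg _))
    have hPR : 0 < P * R := lt_of_le_of_lt (by positivity) hlt
    have hP1 : 0 < P := pos_of_mul_pos_left hPR hR0
    have hR1 : 0 < R := pos_of_mul_pos_right hPR hP0
    have : 0 < P * α + R * β := by
      rcases hα.eq_or_lt with rfl | hα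
      · have : β = 1 := by linarith
        rw [this]; linarith
      · have := mul_pos hP1 hα
        have := mul_nonneg hR0 hβ
        linarith
    linarith
  -- Aligning the phase of the off-diagonal entry with l₁ leaves a real quadratic in x that is
  -- nowhere negative, so its discriminant is at most 0.
  · obtain ⟨e, f, hef, hnorm⟩ : ∃ e f : ℝ, e ^ 2 + f ^ 2 = 1 ∧ l₁.re * e - l₁.im * f = ‖l₁‖ := by
      by_cases h0 : ‖l₁‖ = 0
      · refine ⟨1, 0, by norm_num, ?_⟩
        rw [norm_eq_zero] at h0; simp [h0]
      · refine ⟨l₁.re / ‖l₁‖, -l₁.im / ‖l₁‖, ?_, ?_⟩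
        · field_simp; linarith
        · field_simp; linarith
    have hquad : ∀ x : ℝ, 0 ≤ P * (x * x) + -(2 * (t * ‖l₁‖)) * x + R := by
      intro x
      have hpos : 0 < x ^ 2 + 1 := by positivity
      have := hle' (x ^ 2 / (x ^ 2 + 1)) (1 / (x ^ 2 + 1)) (x / (x ^ 2 + 1) * e)
        (x / (x ^ 2 + 1) * f) (by positivity) (by positivity) (by field_simp)
        (by rw [mul_pow, mul_pow, ← mul_add, hef]; field_simp)
      have heq : ‖l₁‖ ^ 2 * (x ^ 2 / (x ^ 2 + 1)) + (‖l₂‖ ^ 2 + t ^ 2) * (1 / (x ^ 2 + 1)) +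
          2 * t * (l₁.re * (x / (x ^ 2 + 1) * e) - l₁.im * (x / (x ^ 2 + 1) * f)) =
          (‖l₁‖ ^ 2 * x ^ 2 + ‖l₂‖ ^ 2 + t ^ 2 + 2 * t * ‖l₁‖ * x) / (x ^ 2 + 1) := by
        rw [← hnorm]; ring
      rw [heq, div_le_iff₀ hpos] at this
      rw [hP, hR]; linarith
    have := discrim_le_zero hquad
    unfold discrim at this
    linarith

lemma eq_of_touchesFromBelow {l₁ l₂ : ℂ} {t t' N : ℝ} (ht : 0 ≤ t) (ht' : 0 ≤ t')
    (h : TouchesFromBelow (confDisk l₁ l₂ t) N) (h' : TouchesFromBelow (confDisk l₁ l₂ t') N) :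
    t = t' := by
  have e := sub_mul_sub_eq_of_touchesFromBelow h
  have e' := sub_mul_sub_eq_of_touchesFromBelow h'
  have htop : ∀ t, TouchesFromBelow (confDisk l₁ l₂ t) N → ‖l₂‖ ^ 2 + t ^ 2 ≤ N := fun t h => by
    simpa using h.2 _ ⟨0, 1, 0, 0, by simp, by simp, by simp, by simp, rfl⟩
  have b := htop t h
  have b' := htop t' h'
  rw [← abs_of_nonneg ht, ← abs_of_nonneg ht', ← sq_eq_sq_iff_abs_eq_abs]
  -- For N = 0 the bounds force both parameters to vanish; otherwise each quadratic relation
  -- expresses N t² through N, l₁, l₂ alone.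
  by_cases hN : N = 0
  · nlinarith [sq_nonneg ‖l₂‖, sq_nonneg t, sq_nonneg t']
  · exact mul_left_cancel₀ hN (by linarith)

lemma touchesFromBelow_image_toBCK_iff {S : Set (ℝ × ℝ)} (hS : S ⊆ planePCK) {N : ℝ} (hN : 0 ≤ N) :
    TouchesFromBelow (toBCK '' S) ((N - 1) / (N + 1)) ↔ TouchesFromBelow S N := by
  have hle : ∀ p ∈ S, ((toBCK p).2 ≤ (N - 1) / (N + 1) ↔ p.2 ≤ N) := by
    intro p hp
    have := add_one_pos_of_mem_planePCK (hS hp)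
    simp only [toBCK]
    rw [div_le_div_iff₀ this (by linarith)]
    constructor <;> intro h <;> linarith
  have heq : ∀ p ∈ S, ((toBCK p).2 = (N - 1) / (N + 1) ↔ p.2 = N) := by
    intro p hp
    have := add_one_pos_of_mem_planePCK (hS hp)
    simp only [toBCK]
    rw [div_eq_div_iff this.ne' (by linarith)]
    constructor <;> intro h <;> linarith
  unfold TouchesFromBelow
  simp only [Set.exists_mem_image, Set.forall_mem_image]
  exact and_congr (exists_congr fun p => and_congr_right fun hp => heq p hp)
    (forall₂_congr fun p hp => hle p hp)

/-! ### Euclidean ellipticity -/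

/-- A linear map from ℝ³ to the plane kills a unit vector n, so it factors through the orthogonal
projection along n, under which the unit sphere covers the unit disc. -/
lemma isEllipticalDisk_image_sphere (c u v w : ℝ × ℝ) :
    IsEllipticalDisk {p | ∃ r s q : ℝ, r ^ 2 + s ^ 2 + q ^ 2 = 1 ∧
      p = c + (r • u + s • v + q • w)} := by
  let L : EuclideanSpace ℝ (Fin 3) →ₗ[ℝ] ℝ × ℝ :=
    { toFun := fun x => x 0 • u + x 1 • v + x 2 • w
      map_add' := fun x y => by simp only [PiLp.add_apply]; module
      map_smul' := fun k x => by
        simp only [PiLp.smul_apply, smul_eq_mul, RingHom.id_apply]; module }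
  have hset : {p | ∃ r s q : ℝ, r ^ 2 + s ^ 2 + q ^ 2 = 1 ∧ p = c + (r • u + s • v + q • w)} =
      {p | ∃ x : EuclideanSpace ℝ (Fin 3), ‖x‖ = 1 ∧ p = c + L x} := by
    ext p
    constructor
    · rintro ⟨r, s, q, h, rfl⟩
      refine ⟨!₂[r, s, q], ?_, rfl⟩
      rw [EuclideanSpace.norm_eq]
      simp [Fin.sum_univ_three, h]
    · rintro ⟨x, hx, rfl⟩
      refine ⟨x 0, x 1, x 2, ?_, rfl⟩
      rw [EuclideanSpace.norm_eq, sqrt_eq_one] at hx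
      simpa [Fin.sum_univ_three] using hx
  rw [hset]
  obtain ⟨n, hn, hLn⟩ : ∃ n : EuclideanSpace ℝ (Fin 3), ‖n‖ = 1 ∧ L n = 0 := by
    have hker : LinearMap.ker L ≠ ⊥ := LinearMap.ker_ne_bot_of_finrank_lt (by simp)
    obtain ⟨n, hn, hn0⟩ := Submodule.exists_mem_ne_zero_of_ne_bot hker
    refine ⟨‖n‖⁻¹ • n, ?_, ?_⟩
    · rw [norm_smul, norm_inv, norm_norm, inv_mul_cancel₀ (norm_ne_zero_iff.2 hn0)]
    · rw [map_smul, LinearMap.mem_ker.1 hn, smul_zero]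
  obtain ⟨b, hb⟩ : ∃ b : OrthonormalBasis (Fin 3) ℝ (EuclideanSpace ℝ (Fin 3)), b 2 = n := by
    have hon : Orthonormal ℝ (Set.domRestrict {(2 : Fin 3)} (fun _ => n)) := by
      refine ⟨fun _ => hn, fun i j hij => (hij (Subsingleton.elim i j)).elim⟩
    obtain ⟨b, hb⟩ := hon.exists_orthonormalBasis_extension_of_card_eq (by simp)
    exact ⟨b, hb 2 rfl⟩
  have hL : ∀ x : EuclideanSpace ℝ (Fin 3), L x = b.repr x 0 • L (b 0) + b.repr x 1 • L (b 1) := by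
    intro x
    conv_lhs => rw [← b.sum_repr x]
    rw [Fin.sum_univ_three, hb, map_add, map_add, map_smul, map_smul, map_smul, hLn, smul_zero,
      add_zero]
  let M : ℝ × ℝ →ₗ[ℝ] ℝ × ℝ :=
    (LinearMap.fst ℝ ℝ ℝ).smulRight (L (b 0)) + (LinearMap.snd ℝ ℝ ℝ).smulRight (L (b 1))
  refine ⟨AffineMap.const ℝ _ c + M.toAffineMap, ?_⟩
  ext p
  constructor
  · rintro ⟨x, hx, rfl⟩
    refine ⟨(b.repr x 0, b.repr x 1), ?_, ?_⟩
    · rw [← b.repr.norm_map, EuclideanSpace.norm_eq, sqrt_eq_one] at hx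
      simp only [Fin.sum_univ_three, norm_eq_abs, sq_abs] at hx
      change (b.repr x 0) ^ 2 + (b.repr x 1) ^ 2 ≤ 1
      nlinarith [sq_nonneg (b.repr x 2)]
    · rw [hL x]; simp [M]
  · rintro ⟨⟨y, z⟩, hyz, rfl⟩
    change y ^ 2 + z ^ 2 ≤ 1 at hyz
    -- Lift the disc point to the hemisphere on the side of n.
    refine ⟨b.repr.symm !₂[y, z, √(1 - y ^ 2 - z ^ 2)], ?_, ?_⟩
    · rw [LinearIsometryEquiv.norm_map, EuclideanSpace.norm_eq, sqrt_eq_one]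
      simp only [Fin.sum_univ_three, norm_eq_abs, sq_abs]
      simp [sq_sqrt (show 0 ≤ 1 - y ^ 2 - z ^ 2 by linarith)]
    · rw [hL]; simp [M]

/-- The projective image of the cone of rank one density matrices, normalized by a positive
definite hermitian form, is an elliptical disc. -/
lemma isEllipticalDisk_image_cone {A B C D : ℝ} (hA : 0 < A) (hdet : 0 < A * B - (C ^ 2 + D ^ 2))
    (p₁ p₂ p₃ p₄ : ℝ × ℝ) :
    IsEllipticalDisk {p | ∃ α β g h : ℝ, 0 ≤ α ∧ 0 ≤ β ∧ g ^ 2 + h ^ 2 = α * β ∧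
      A * α + B * β + 2 * (C * g + D * h) = 1 ∧ p = α • p₁ + β • p₂ + g • p₃ + h • p₄} := by
  set d := A * B - (C ^ 2 + D ^ 2) with hd
  obtain ⟨e, he, hed⟩ : ∃ e : ℝ, 0 < e ∧ e ^ 2 = d := ⟨√d, sqrt_pos.2 hdet, sq_sqrt hdet.le⟩
  have key : {p : ℝ × ℝ | ∃ α β g h : ℝ, 0 ≤ α ∧ 0 ≤ β ∧ g ^ 2 + h ^ 2 = α * β ∧
      A * α + B * β + 2 * (C * g + D * h) = 1 ∧ p = α • p₁ + β • p₂ + g • p₃ + h • p₄} =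
    {p | ∃ r s q : ℝ, r ^ 2 + s ^ 2 + q ^ 2 = 1 ∧ p =
      ((1 + (C ^ 2 + D ^ 2) / d) / (2 * A)) • p₁ + (A / (2 * d)) • p₂ - (C / (2 * d)) • p₃ -
        (D / (2 * d)) • p₄ +
      (r • (((1 - (C ^ 2 + D ^ 2) / d) / (2 * A)) • p₁ - (A / (2 * d)) • p₂ + (C / (2 * d)) • p₃ +
        (D / (2 * d)) • p₄) +
       s • ((-(C / (e * A))) • p₁ + (1 / (2 * e)) • p₃) +
       q • ((-(D / (e * A))) • p₁ + (1 / (2 * e)) • p₄))} := by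
    ext p
    constructor
    · rintro ⟨α, β, g, h, hα, hβ, hgh, hG, rfl⟩
      -- Eliminating α by the normalization and completing squares in g, h and then β turns the cone
      -- equation into the unit sphere.
      have hr : (1 - 2 * (d / A * β)) ^ 2 + (2 * e * (g + C * β / A)) ^ 2 +
          (2 * e * (h + D * β / A)) ^ 2 = 1 := by
        have : (g + C * β / A) ^ 2 + (h + D * β / A) ^ 2 = β / A * (1 - d / A * β) := by
          rw [hd]
          field_simp
          linear_combination A ^ 2 * hgh + A * β * hG
        linear_combination 4 * e ^ 2 * this + 4 * (β / A * (1 - d / A * β)) * hed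
      refine ⟨_, _, _, hr, ?_⟩
      have hα' : α = (1 - B * β - 2 * (C * g + D * h)) / A := by field_simp; linarith
      have hB : B = (e ^ 2 + (C ^ 2 + D ^ 2)) / A := by rw [hed, hd]; field_simp; ring
      rw [hα', hB, ← hed]
      match_scalars <;> field_simp <;> ring
    · rintro ⟨r, s, q, hr, rfl⟩
      have hB : B = (e ^ 2 + (C ^ 2 + D ^ 2)) / A := by rw [hed, hd]; field_simp; ring
      have hβ : 0 ≤ A * (1 - r) / (2 * d) := by
        have : 0 ≤ 1 - r := by nlinarith [sq_nonneg s, sq_nonneg q]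
        positivity
      have hgh : (s / (2 * e) - C * (1 - r) / (2 * d)) ^ 2 +
          (q / (2 * e) - D * (1 - r) / (2 * d)) ^ 2 =
          (((1 + r) / 2 - (C * s + D * q) / e + (C ^ 2 + D ^ 2) * (1 - r) / (2 * d)) / A) *
            (A * (1 - r) / (2 * d)) := by
        rw [← hed]
        field_simp
        linear_combination e ^ 2 * hr
      refine ⟨((1 + r) / 2 - (C * s + D * q) / e + (C ^ 2 + D ^ 2) * (1 - r) / (2 * d)) / A,
        A * (1 - r) / (2 * d), s / (2 * e) - C * (1 - r) / (2 * d),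
        q / (2 * e) - D * (1 - r) / (2 * d), ?_, hβ, hgh, ?_, ?_⟩
      -- For β > 0 the sign of α follows from αβ = g² + h² ≥ 0; β = 0 is the pole r = 1, s = q = 0.
      · rcases hβ.eq_or_lt with h0 | h0
        · have hr1 : r = 1 := by
            have : A * (1 - r) = 0 := by
              rcases div_eq_zero_iff.1 h0.symm with h | h
              · exact h
              · linarith
            rcases mul_eq_zero.1 this with h | h <;> linarith
          subst hr1
          have hs : s = 0 := by nlinarith [sq_nonneg s, sq_nonneg q]
          have hq : q = 0 := by nlinarith [sq_nonneg s, sq_nonneg q]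
          rw [hs, hq]; simp; positivity
        · exact nonneg_of_mul_nonneg_left (hgh ▸ by positivity) h0
      · rw [hB, ← hed]
        field_simp
        ring
      · match_scalars <;> field_simp <;> ring
  rw [key]
  exact isEllipticalDisk_image_sphere _ _ _ _

lemma isEllipticalDisk_confDisk (l₁ l₂ : ℂ) (t : ℝ) : IsEllipticalDisk (confDisk l₁ l₂ t) := by
  have := isEllipticalDisk_image_cone (A := 1) (B := 1) (C := 0) (D := 0) one_pos (by norm_num)
    (l₁.re, ‖l₁‖ ^ 2) (l₂.re, ‖l₂‖ ^ 2 + t ^ 2) (t, 2 * t * l₁.re) (0, -(2 * t * l₁.im))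
  convert this using 1
  ext p
  simp only [confDisk, Set.mem_ofPred_eq]
  refine exists_congr fun α => exists_congr fun β => exists_congr fun g => exists_congr fun h =>
    and_congr_right fun _ => and_congr_right fun _ => ?_
  rw [and_left_comm]
  refine and_congr_right fun _ => and_congr (by simp) ?_
  have : ((l₁.re * α + l₂.re * β + t * g,
      ‖l₁‖ ^ 2 * α + (‖l₂‖ ^ 2 + t ^ 2) * β + 2 * t * (l₁.re * g - l₁.im * h)) : ℝ × ℝ) =
      α • (l₁.re, ‖l₁‖ ^ 2) + β • (l₂.re, ‖l₂‖ ^ 2 + t ^ 2) + g • (t, 2 * t * l₁.re) +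
        h • (0, -(2 * t * l₁.im)) := by
    ext <;> simp <;> ring
  rw [this]

lemma isEllipticalDisk_image_confDisk (l₁ l₂ : ℂ) (t : ℝ) :
    IsEllipticalDisk (toBCK '' confDisk l₁ l₂ t) := by
  have hn := norm_sq_eq l₁
  -- The normalizing form is that of A*A + 1, for which |Ax|² + |x|² is the quadratic form.
  have hdet : 0 < (‖l₁‖ ^ 2 + 1) * (‖l₂‖ ^ 2 + t ^ 2 + 1) - ((t * l₁.re) ^ 2 + (-(t * l₁.im)) ^ 2) := by
    have : (‖l₁‖ ^ 2 + 1) * (‖l₂‖ ^ 2 + t ^ 2 + 1) - ((t * l₁.re) ^ 2 + (-(t * l₁.im)) ^ 2) =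
        (‖l₁‖ ^ 2 + 1) * (‖l₂‖ ^ 2 + 1) + t ^ 2 := by
      linear_combination t ^ 2 * hn
    rw [this]; positivity
  have := isEllipticalDisk_image_cone (A := ‖l₁‖ ^ 2 + 1) (by positivity) hdet
    (2 * l₁.re, ‖l₁‖ ^ 2 - 1) (2 * l₂.re, ‖l₂‖ ^ 2 + t ^ 2 - 1) (2 * t, 2 * t * l₁.re)
    (0, -(2 * t * l₁.im))
  convert this using 1
  ext p
  simp only [Set.mem_image, Set.mem_ofPred_eq]
  constructor
  · rintro ⟨_, hp, rfl⟩
    have hG := add_one_pos_of_mem_planePCK (confDisk_subset_planePCK _ _ _ hp)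
    obtain ⟨α, β, g, h, hα, hβ, hs, hgh, rfl⟩ := hp
    simp only at hG
    set G := ‖l₁‖ ^ 2 * α + (‖l₂‖ ^ 2 + t ^ 2) * β + 2 * t * (l₁.re * g - l₁.im * h) + 1 with hG'
    refine ⟨α / G, β / G, g / G, h / G, by positivity, by positivity, ?_, ?_, ?_⟩
    · field_simp; exact hgh
    · field_simp
      rw [hG']; linear_combination hs
    · simp only [toBCK, ← hG']
      ext
      · simp; ring
      · simp
        field_simp
        linear_combination hG' + hs
  · rintro ⟨α, β, g, h, hα, hβ, hgh, hG, rfl⟩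
    have hs : 0 < α + β := by
      rcases (add_nonneg hα hβ).eq_or_lt with h0 | h0
      · have hα0 : α = 0 := by linarith
        have hβ0 : β = 0 := by linarith
        have hg : g = 0 := by nlinarith [sq_nonneg g, sq_nonneg h]
        have hh : h = 0 := by nlinarith [sq_nonneg g, sq_nonneg h]
        rw [hα0, hβ0, hg, hh] at hG
        norm_num at hG
      · exact h0
    refine ⟨_, ⟨α / (α + β), β / (α + β), g / (α + β), h / (α + β), by positivity, by positivity,
      by field_simp, by field_simp; exact hgh, rfl⟩, ?_⟩
    have hz : ‖l₁‖ ^ 2 * (α / (α + β)) + (‖l₂‖ ^ 2 + t ^ 2) * (β / (α + β)) +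
        2 * t * (l₁.re * (g / (α + β)) - l₁.im * (h / (α + β))) = (1 - (α + β)) / (α + β) := by
      field_simp
      linear_combination hG
    simp only [toBCK, hz]
    have h1 : (1 - (α + β)) / (α + β) + 1 = 1 / (α + β) := by field_simp; ring
    rw [h1]
    ext
    · simp; field_simp
    · simp; field_simp; linear_combination -hG

/-! ### Reduction of the operator to triangular form -/

variable {H : Type*} [NormedAddCommGroup H] [InnerProductSpace ℂ H]

lemma rangeBCK_eq_image (A : H →L[ℂ] H) : rangeBCK A = toBCK '' rangePCK A := by
  have key : ∀ x : H, x ≠ 0 →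
      toBCK ((inner ℂ (A x) x).re / ‖x‖ ^ 2, ‖A x‖ ^ 2 / ‖x‖ ^ 2) =
      (2 * (inner ℂ (A x) x).re / (‖A x‖ ^ 2 + ‖x‖ ^ 2),
        (‖A x‖ ^ 2 - ‖x‖ ^ 2) / (‖A x‖ ^ 2 + ‖x‖ ^ 2)) := by
    intro x hx
    have := norm_pos_iff.2 hx
    have h : ‖A x‖ ^ 2 / ‖x‖ ^ 2 + 1 = (‖A x‖ ^ 2 + ‖x‖ ^ 2) / ‖x‖ ^ 2 := by field_simp
    simp only [toBCK, h]
    ext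
    · simp only; field_simp
    · simp only; field_simp
  ext p
  constructor
  · rintro ⟨x, hx, rfl⟩
    exact ⟨_, ⟨x, hx, rfl⟩, key x hx⟩
  · rintro ⟨_, ⟨x, hx, rfl⟩, rfl⟩
    exact ⟨x, hx, key x hx⟩

lemma touchesFromBelow_rangePCK [FiniteDimensional ℂ H] [Nontrivial H] (A : H →L[ℂ] H) :
    TouchesFromBelow (rangePCK A) (‖A‖ ^ 2) := by
  have hle : ∀ p ∈ rangePCK A, p.2 ≤ ‖A‖ ^ 2 := by
    rintro _ ⟨x, hx, rfl⟩
    have := norm_pos_iff.2 hx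
    simp only
    rw [div_le_iff₀ (by positivity), ← mul_pow]
    gcongr
    exact A.le_opNorm x
  refine ⟨?_, hle⟩
  have : ProperSpace H := FiniteDimensional.proper ℂ H
  let _ : NormedSpace ℝ H := NormedSpace.restrictScalars ℝ ℂ H
  obtain ⟨x, hx, hmax⟩ := (isCompact_sphere (0 : H) 1).exists_isMaxOn
    (NormedSpace.sphere_nonempty.2 zero_le_one) A.continuous.norm.continuousOn
  have hx1 : ‖x‖ = 1 := by simpa using hx
  have hx0 : x ≠ 0 := by rw [← norm_ne_zero_iff, hx1]; exact one_ne_zero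
  refine ⟨_, ⟨x, hx0, rfl⟩, ?_⟩
  have hA : ‖A‖ = ‖A x‖ := by
    refine le_antisymm (A.opNorm_le_of_unit_norm (norm_nonneg _) fun y hy => ?_) ?_
    · exact hmax (by simpa using hy)
    · simpa [hx1] using A.le_opNorm x
  simp [hx1, hA]

/-- Schur form of an operator on a two-dimensional space, with a nonnegative off-diagonal entry. -/
lemma exists_schur_basis [FiniteDimensional ℂ H] (hH : Module.finrank ℂ H = 2) (A : H →L[ℂ] H)
    {l₁ l₂ : ℂ} (hA : (A : H →ₗ[ℂ] H).charpoly.roots = {l₁, l₂}) :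
    ∃ (e₁ e₂ : H) (t : ℝ), 0 ≤ t ∧ ‖e₁‖ = 1 ∧ ‖e₂‖ = 1 ∧ inner ℂ e₁ e₂ = 0 ∧
      A e₁ = l₁ • e₁ ∧ A e₂ = (t : ℂ) • e₁ + l₂ • e₂ ∧ ∀ x, ∃ a b : ℂ, x = a • e₁ + b • e₂ := by
  obtain ⟨v, hv⟩ : ∃ v, Module.End.HasEigenvector (A : H →ₗ[ℂ] H) l₁ v := by
    refine Module.End.HasEigenvalue.exists_hasEigenvector ?_
    rw [Module.End.hasEigenvalue_iff_isRoot_charpoly]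
    refine Polynomial.isRoot_of_mem_roots ?_
    rw [hA]; simp
  obtain ⟨e₁, he₁, hAe₁⟩ : ∃ e₁ : H, ‖e₁‖ = 1 ∧ A e₁ = l₁ • e₁ := by
    have hv0 := hv.2
    have hvA : A v = l₁ • v := hv.apply_eq_smul
    refine ⟨((‖v‖⁻¹ : ℝ) : ℂ) • v, ?_, ?_⟩
    · rw [norm_smul, Complex.norm_real, norm_inv, norm_norm, inv_mul_cancel₀ (norm_ne_zero_iff.2 hv0)]
    · rw [map_smul, hvA, smul_comm]
  obtain ⟨b, hb⟩ : ∃ b : OrthonormalBasis (Fin 2) ℂ H, b 0 = e₁ := by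
    have hon : Orthonormal ℂ (Set.domRestrict {(0 : Fin 2)} (fun _ => e₁)) :=
      ⟨fun _ => he₁, fun i j hij => (hij (Subsingleton.elim i j)).elim⟩
    obtain ⟨b, hb⟩ := hon.exists_orthonormalBasis_extension_of_card_eq (by simp [hH])
    exact ⟨b, hb 0 rfl⟩
  set c : ℂ := inner ℂ e₁ (A (b 1)) with hc
  have hAb : A (b 1) = c • e₁ + l₂ • b 1 := by
    -- The trace identifies the second diagonal entry as l₂.
    have htr : l₁ + l₂ = l₁ + inner ℂ (b 1) (A (b 1)) := by
      have h1 := Module.End.trace_eq_sum_roots_charpoly_of_splits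
        (IsAlgClosed.splits (A : H →ₗ[ℂ] H).charpoly)
      rw [hA, LinearMap.trace_eq_sum_inner _ b, Fin.sum_univ_two, hb] at h1
      simp only [ContinuousLinearMap.coe_coe, hAe₁, inner_smul_right, inner_self_eq_norm_sq_to_K,
        he₁] at h1
      simpa using h1.symm
    rw [add_left_cancel htr]
    conv_lhs => rw [← b.sum_repr' (A (b 1)), Fin.sum_univ_two, hb]
  -- A unimodular factor on the second basis vector makes the off-diagonal entry equal to |c|.
  obtain ⟨ω, hω, hωc⟩ : ∃ ω : ℂ, ‖ω‖ = 1 ∧ ω * c = (‖c‖ : ℝ) := by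
    by_cases h0 : c = 0
    · exact ⟨1, by simp, by simp [h0]⟩
    · refine ⟨(starRingEnd ℂ) c / ‖c‖, ?_, ?_⟩
      · simp [h0]
      · have : (‖c‖ : ℂ) ≠ 0 := by simpa using h0
        rw [div_mul_eq_mul_div, mul_comm, Complex.mul_conj, Complex.normSq_eq_norm_sq]
        field_simp
        push_cast; ring
  have hω0 : ω ≠ 0 := by rw [← norm_ne_zero_iff, hω]; exact one_ne_zero
  refine ⟨e₁, ω • b 1, ‖c‖, norm_nonneg _, he₁, ?_, ?_, hAe₁, ?_, fun x => ?_⟩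
  · rw [norm_smul, hω, b.orthonormal.1, one_mul]
  · rw [inner_smul_right, ← hb, b.orthonormal.2 (by decide), mul_zero]
  · rw [map_smul, hAb, smul_add, smul_smul, hωc, smul_comm]
  · refine ⟨inner ℂ (b 0) x, inner ℂ (b 1) x / ω, ?_⟩
    rw [smul_smul, div_mul_cancel₀ _ hω0, ← hb]
    conv_lhs => rw [← b.sum_repr' x, Fin.sum_univ_two]

lemma inner_orthonormal_pair {e₁ e₂ : H} (h₁ : ‖e₁‖ = 1) (h₂ : ‖e₂‖ = 1) (h₁₂ : inner ℂ e₁ e₂ = 0)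
    (a b c d : ℂ) : inner ℂ (a • e₁ + b • e₂) (c • e₁ + d • e₂) =
      (starRingEnd ℂ) a * c + (starRingEnd ℂ) b * d := by
  have h₂₁ : inner ℂ e₂ e₁ = 0 := inner_eq_zero_symm.1 h₁₂
  simp [h₁₂, h₂₁, inner_self_eq_norm_sq_to_K, h₁, h₂, mul_comm]

/-- For a unit vector with coordinates (a, b), the density entries are α = |a|², β = |b|² and g + ih
= a times the conjugate of b. -/
lemma rangePCK_eq_confDisk {A : H →L[ℂ] H} {l₁ l₂ : ℂ} {e₁ e₂ : H} {t : ℝ} (h₁ : ‖e₁‖ = 1)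
    (h₂ : ‖e₂‖ = 1) (h₁₂ : inner ℂ e₁ e₂ = 0) (hA₁ : A e₁ = l₁ • e₁)
    (hA₂ : A e₂ = (t : ℂ) • e₁ + l₂ • e₂) (hspan : ∀ x, ∃ a b : ℂ, x = a • e₁ + b • e₂) :
    rangePCK A = confDisk l₁ l₂ t := by
  have hnorm : ∀ a b : ℂ, ‖a • e₁ + b • e₂‖ ^ 2 = a.re ^ 2 + a.im ^ 2 + (b.re ^ 2 + b.im ^ 2) := by
    intro a b
    rw [← inner_self_eq_norm_sq (𝕜 := ℂ), inner_orthonormal_pair h₁ h₂ h₁₂]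
    simp; ring
  have hAx : ∀ a b : ℂ, A (a • e₁ + b • e₂) = (l₁ * a + t * b) • e₁ + (l₂ * b) • e₂ := by
    intro a b
    rw [map_add, map_smul, map_smul, hA₁, hA₂]; module
  have hform : ∀ a b : ℂ, (inner ℂ (A (a • e₁ + b • e₂)) (a • e₁ + b • e₂)).re =
        l₁.re * (a.re ^ 2 + a.im ^ 2) + l₂.re * (b.re ^ 2 + b.im ^ 2) +
          t * (a.re * b.re + a.im * b.im) ∧
      ‖A (a • e₁ + b • e₂)‖ ^ 2 = ‖l₁‖ ^ 2 * (a.re ^ 2 + a.im ^ 2) +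
        (‖l₂‖ ^ 2 + t ^ 2) * (b.re ^ 2 + b.im ^ 2) +
        2 * t * (l₁.re * (a.re * b.re + a.im * b.im) - l₁.im * (a.im * b.re - a.re * b.im)) := by
    intro a b
    rw [hAx, inner_orthonormal_pair h₁ h₂ h₁₂, hnorm, norm_sq_eq, norm_sq_eq]
    constructor
    · simp; ring
    · simp; ring
  ext p
  constructor
  · rintro ⟨x, hx, rfl⟩
    obtain ⟨a, b, rfl⟩ := hspan x
    have hn := norm_pos_iff.2 hx
    obtain ⟨f1, f2⟩ := hform a b
    set n := ‖a • e₁ + b • e₂‖ ^ 2 with hn'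
    have hn0 : 0 < n := by positivity
    rw [f1, f2]
    refine ⟨(a.re ^ 2 + a.im ^ 2) / n, (b.re ^ 2 + b.im ^ 2) / n, (a.re * b.re + a.im * b.im) / n,
      (a.im * b.re - a.re * b.im) / n, by positivity, by positivity, ?_, ?_, ?_⟩
    · rw [← add_div, div_eq_one_iff_eq hn0.ne', hn', hnorm]
    · field_simp; ring
    · ext
      · simp only; field_simp
      · simp only; field_simp
  · rintro ⟨α, β, g, h, hα, hβ, hs, hgh, rfl⟩
    obtain ⟨a, b, e1, e2, e3, e4⟩ : ∃ a b : ℂ, a.re ^ 2 + a.im ^ 2 = α ∧ b.re ^ 2 + b.im ^ 2 = β ∧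
        a.re * b.re + a.im * b.im = g ∧ a.im * b.re - a.re * b.im = h := by
      rcases hα.eq_or_lt with rfl | hα
      · have hg : g = 0 := by nlinarith [sq_nonneg g, sq_nonneg h]
        have hh : h = 0 := by nlinarith [sq_nonneg g, sq_nonneg h]
        exact ⟨0, 1, by simp, by simp; linarith, by simp [hg], by simp [hh]⟩
      · have hr : 0 < √α := sqrt_pos.2 hα
        have hr2 : √α ^ 2 = α := sq_sqrt hα.le
        -- The phase is fixed by taking a real and positive; b is then forced.
        refine ⟨⟨√α, 0⟩, ⟨g / √α, -h / √α⟩, by simp [hr2], ?_, ?_, ?_⟩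
        · simp only
          field_simp
          rw [hr2]; linarith
        · simp only; field_simp; ring
        · simp only; field_simp; ring
    have hn := hnorm a b
    rw [e1, e2, hs] at hn
    obtain ⟨f1, f2⟩ := hform a b
    rw [e1, e2, e3] at f1
    rw [e1, e2, e3, e4] at f2
    refine ⟨a • e₁ + b • e₂, ?_, ?_⟩
    · intro h0; rw [h0] at hn; simp at hn
    · rw [hn, f1, f2, div_one, div_one]

lemma image_ssubset_planeBCK {S : Set (ℝ × ℝ)} (hS : S ⊆ planePCK) : toBCK '' S ⊂ planeBCK := by
  refine ⟨?_, fun h => ?_⟩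
  · rintro _ ⟨p, hp, rfl⟩
    exact toBCK_mem_planeBCK (hS hp)
  -- The ideal point (0, 1) is never reached.
  · obtain ⟨p, hp, hp1⟩ := h (show ((0, 1) : ℝ × ℝ) ∈ planeBCK by simp [planeBCK])
    have hpos := add_one_pos_of_mem_planePCK (hS hp)
    have h2 := congrArg Prod.snd hp1
    simp only [toBCK] at h2
    rw [div_eq_one_iff_eq hpos.ne'] at h2
    linarith

lemma TouchesFromBelow.ssubset_planePCK {S : Set (ℝ × ℝ)} {N : ℝ} (h : TouchesFromBelow S N)
    (hN : 0 ≤ N) (hS : S ⊆ planePCK) : S ⊂ planePCK := by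
  refine ⟨hS, fun hsub => ?_⟩
  have := h.2 _ (hsub (show ((0, N + 1) : ℝ × ℝ) ∈ planePCK by
    simp only [planePCK, Set.mem_ofPred_eq]; linarith))
  simp only at this
  linarith

end ConformalRange

/-! ### Conclusion -/

open ConformalRange

theorem mainTheorem8 {H : Type*} [NormedAddCommGroup H] [InnerProductSpace ℂ H]
    [FiniteDimensional ℂ H] (hH : Module.finrank ℂ H = 2) (A : H →L[ℂ] H) (l₁ l₂ : ℂ)
    (hA : (A : H →ₗ[ℂ] H).charpoly.roots = {l₁, l₂}) :
    -- BCK model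
    ((ConformalRange.rangeBCK A ⊂ ConformalRange.planeBCK ∧
        ConformalRange.IsEllipticalDisk (ConformalRange.rangeBCK A)) ∧
      ConformalRange.IsFocalDisk (ConformalRange.iotaBCK l₁) (ConformalRange.iotaBCK l₂)
        (ConformalRange.rangeBCK A) ∧
      ConformalRange.TouchesFromBelow (ConformalRange.rangeBCK A)
        ((‖A‖ ^ 2 - 1) / (‖A‖ ^ 2 + 1)) ∧
      ∀ S : Set (ℝ × ℝ),
        ConformalRange.IsFocalDisk (ConformalRange.iotaBCK l₁) (ConformalRange.iotaBCK l₂) S →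
        ConformalRange.TouchesFromBelow S ((‖A‖ ^ 2 - 1) / (‖A‖ ^ 2 + 1)) →
        S = ConformalRange.rangeBCK A) ∧
    -- pCK model
    ((ConformalRange.rangePCK A ⊂ ConformalRange.planePCK ∧
        ConformalRange.IsEllipticalDisk (ConformalRange.rangePCK A)) ∧
      ConformalRange.IsFocalDiskPCK (ConformalRange.iotaPCK l₁) (ConformalRange.iotaPCK l₂)
        (ConformalRange.rangePCK A) ∧
      ConformalRange.TouchesFromBelow (ConformalRange.rangePCK A) (‖A‖ ^ 2) ∧
      ∀ S : Set (ℝ × ℝ),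
        ConformalRange.IsFocalDiskPCK (ConformalRange.iotaPCK l₁) (ConformalRange.iotaPCK l₂) S →
        ConformalRange.TouchesFromBelow S (‖A‖ ^ 2) →
        S = ConformalRange.rangePCK A) := by
  have : Nontrivial H := Module.nontrivial_of_finrank_pos (R := ℂ) (by omega)
  obtain ⟨e₁, e₂, t, ht, h₁, h₂, h₁₂, hA₁, hA₂, hspan⟩ := exists_schur_basis hH A hA
  have hP := rangePCK_eq_confDisk h₁ h₂ h₁₂ hA₁ hA₂ hspan
  have hB := rangeBCK_eq_image A
  have htop := touchesFromBelow_rangePCK A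
  rw [hP] at hB htop
  have hsub := confDisk_subset_planePCK l₁ l₂ t
  have hN : 0 ≤ ‖A‖ ^ 2 := by positivity
  have hfoc := isFocalDisk_image_confDisk l₁ l₂ t
  have huniq : ∀ S : Set (ℝ × ℝ), IsFocalDisk (iotaBCK l₁) (iotaBCK l₂) S →
      TouchesFromBelow S ((‖A‖ ^ 2 - 1) / (‖A‖ ^ 2 + 1)) → S = toBCK '' confDisk l₁ l₂ t := by
    intro S hS hS'
    obtain ⟨t', ht', rfl⟩ := hS.exists_eq_image_confDisk
    rw [touchesFromBelow_image_toBCK_iff (confDisk_subset_planePCK l₁ l₂ t') hN] at hS'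
    rw [eq_of_touchesFromBelow ht ht' htop hS']
  rw [hB, hP]
  refine ⟨⟨⟨image_ssubset_planeBCK hsub, isEllipticalDisk_image_confDisk l₁ l₂ t⟩, hfoc,
    (touchesFromBelow_image_toBCK_iff hsub hN).2 htop, huniq⟩,
    ⟨htop.ssubset_planePCK hN hsub, isEllipticalDisk_confDisk l₁ l₂ t⟩, ⟨hsub, hfoc⟩, htop, ?_⟩
  rintro S ⟨hS, hS'⟩ hS''
  refine (toBCK_injOn.image_eq_image_iff hS hsub).1 (huniq _ hS' ?_)
  exact (touchesFromBelow_image_toBCK_iff hS hN).2 hS''
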